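/- Let $(X,\mathcal F,\mu)$ be a $\sigma$-finite measure space and let $\Phi:\mathbb R\to[0,\infty]$ be a Young function, i.e. $\Phi$ is convex and even, $\Phi(0)=0$ and $\Phi(x)\to\infty$ as $x\to\infty$. Assume $\Phi\in\Delta'$: there are $c>0$ and $x_0\ge 0$ with $\Phi(xy)\le c\,\Phi(x)\Phi(y)$ for all $x,y\ge x_0$. Write $\Phi^{-1}(y)=\inf\{x\ge 0:\Phi(x)>y\}$, let $L^\Phi(\mu)$ be the real Orlicz space of classes of measurable $f:X\to\mathbb R$ with $\int_X\Phi(kf)\,d\mu<\infty$ for some $k>0$, and equip it with the gauge norm $N_\Phi(f)=\inf\{k>0:\int_X\Phi(f/k)\,d\mu\le 1\}$. Let $\varphi:X\to X$ be a bijection with $\varphi$ and $\varphi^{-1}$ measurable, such that for some $c>0$ both $\mu(\varphi^{-1}(A))\le c\,\mu(A)$ and $\mu(\varphi(A))\le c\,\mu(A)$ hold for all $A\in\mathcal F$, and let $C_\varphi f=f\circ\varphi$ on $L^\Phi(\mu)$. Assume that the system is dissipative of bounded distortion, generated by a set $W\in\mathcal F$ with $0<\mu(W)<\infty$: the sets $\varphi^k(W)$,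 $k\in\mathbb Z$, are pairwise disjoint with union $X$, and there is $K>0$ such that $$\frac1K\,\frac{N_\Phi(\chi_W\circ\varphi^k)}{N_\Phi(\chi_W)}\le\frac{N_\Phi(\chi_F\circ\varphi^k)}{N_\Phi(\chi_F)}\le K\,\frac{N_\Phi(\chi_W\circ\varphi^k)}{N_\Phi(\chi_W)}$$ for all $k\in\mathbb Z$ and all measurable $F\subseteq W$ with $\mu(F)>0$. Put $u_k=\Phi^{-1}\big(1/\mu(\varphi^k(W))\big)$ for $k\in\mathbb Z$, and suppose that at least one of the following conditions holds: (hc) $\displaystyle\limsup_{n\to\infty}\ \sup_{k\in\mathbb Z}\Big(\frac{u_{k+n}}{u_k}\Big)^{1/n}<1$; (hd) $\displaystyle\liminf_{n\to\infty}\ \inf_{k\in\mathbb Z}\Big(\frac{u_{k+n}}{u_k}\Big)^{1/n}>1$; (gh) $\displaystyle\limsup_{n\to\infty}\ \sup_{k\le 0}\Big(\frac{u_k}{u_{k-n}}\Big)^{1/n}<1$, and in addition either $\displaystyle\liminf_{n\to\infty}\ \inf_{k\ge 0}\Big(\frac{u_{k+n}}{u_k}\Big)^{1/n}>1$ or $\displaystyle\liminf_{n\to\infty}\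 \inf_{k\ge 0}\Big(\frac{u_k}{u_{k+n}}\Big)^{1/n}>1$. Then $C_\varphi$ is strongly structurally stable on $L^\Phi(\mu)$: it is an invertible bounded operator, and for every $\varepsilon>0$ there is $\delta>0$ such that for every Lipschitz map $\alpha:L^\Phi(\mu)\to L^\Phi(\mu)$ with $\sup_f N_\Phi(\alpha(f))\le\delta$ and Lipschitz constant at most $\delta$ there is a homeomorphism $h$ of $L^\Phi(\mu)$ with $h\circ C_\varphi=(C_\varphi+\alpha)\circ h$ and $\sup_f N_\Phi(h(f)-f)\le\varepsilon$. -/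

import Mathlib

open MeasureTheory Filter Topology
open scoped NNReal ENNReal

noncomputable section

/-- A Young function: an even convex function `Φ : ℝ → [0, ∞]` with `Φ 0 = 0` and
`Φ x → ∞` as `x → ∞`. -/
structure YoungFunction where
  toFun : ℝ → ℝ≥0∞
  convex : ConvexOn ℝ≥0 Set.univ toFun
  even : ∀ x, toFun (-x) = toFun x
  map_zero : toFun 0 = 0
  tendsto_top : Tendsto toFun atTop (𝓝 ∞)

namespace YoungFunction

instance : CoeFun YoungFunction (fun _ => ℝ → ℝ≥0∞) := ⟨toFun⟩

/-- The growth condition `Δ'`: there are `c > 0` and `x₀ ≥ 0` with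
`Φ (x y) ≤ c Φ(x) Φ(y)` for all `x, y ≥ x₀`. -/
def DeltaPrime (Φ : YoungFunction) : Prop :=
  ∃ c : ℝ≥0, 0 < c ∧ ∃ x₀ : ℝ, 0 ≤ x₀ ∧ ∀ x y : ℝ, x₀ ≤ x → x₀ ≤ y →
    Φ (x * y) ≤ c * (Φ x * Φ y)

/-- The generalized inverse `Φ⁻¹(y) = inf {x ≥ 0 : Φ(x) > y}`. -/
def inverse (Φ : YoungFunction) (y : ℝ≥0∞) : ℝ≥0∞ :=
  ⨅ (x : ℝ≥0) (_ : y < Φ (x : ℝ)), (x : ℝ≥0∞)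

lemma smul_le (Φ : YoungFunction) (t : ℝ≥0) (ht : t ≤ 1) (x : ℝ) :
    Φ ((t : ℝ) * x) ≤ t * Φ x := by
  have h : Φ (t • x + (1 - t) • (0 : ℝ)) ≤ t • Φ x + (1 - t) • Φ 0 :=
    Φ.convex.2 (Set.mem_univ x) (Set.mem_univ (0 : ℝ)) zero_le zero_le
      (add_tsub_cancel_of_le ht)
  simpa [Φ.map_zero, NNReal.smul_def, ENNReal.smul_def] using h

lemma mono (Φ : YoungFunction) {x y : ℝ} (hx : 0 ≤ x) (hxy : x ≤ y) : Φ x ≤ Φ y := by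
  rcases hx.eq_or_lt with rfl | h0
  · simp [Φ.map_zero]
  have hy : 0 < y := h0.trans_le hxy
  obtain ⟨t, ht'⟩ : ∃ t : ℝ≥0, (t : ℝ) = x / y := ⟨(x / y).toNNReal,
    Real.coe_toNNReal _ (by positivity)⟩
  have ht : t ≤ 1 := by
    rw [← NNReal.coe_le_coe, ht']; simpa using (div_le_one hy).2 hxy
  have h := Φ.smul_le t ht y
  rw [ht', div_mul_cancel₀ _ hy.ne'] at h
  refine h.trans ?_
  calc _ ≤ (1 : ℝ≥0∞) * Φ y := by gcongr; exact_mod_cast ht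
    _ = Φ y := one_mul _

lemma map_abs (Φ : YoungFunction) (x : ℝ) : Φ |x| = Φ x := by
  rcases abs_choice x with h | h <;> rw [h]
  exact Φ.even x

lemma measurable (Φ : YoungFunction) : Measurable Φ.toFun := by
  have h : Monotone (fun x : ℝ => Φ (max x 0)) := fun x y hxy =>
    Φ.mono (le_max_right _ _) (max_le_max_right _ hxy)
  have e : Φ.toFun = (fun x : ℝ => Φ (max x 0)) ∘ (fun x : ℝ => |x|) := by
    funext x; simp [Φ.map_abs]
  rw [e]
  exact h.measurable.comp measurable_norm

end YoungFunction

variable {X : Type*} [MeasurableSpace X]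

/-- The modular `ρ_Φ(f) = ∫ Φ(f) dμ`. -/
def orliczModular (Φ : YoungFunction) (μ : Measure X) (f : X → ℝ) : ℝ≥0∞ :=
  ∫⁻ x, Φ (f x) ∂μ

/-- The gauge (Luxemburg) functional `N_Φ(f) = inf {k > 0 : ρ_Φ(f / k) ≤ 1}`. -/
def gaugeNorm (Φ : YoungFunction) (μ : Measure X) (f : X → ℝ) : ℝ :=
  sInf {k : ℝ | 0 < k ∧ orliczModular Φ μ (fun x => f x / k) ≤ 1}

section Modular

variable (Φ : YoungFunction) (μ : Measure X)

lemma orliczModular_congr {f g : X → ℝ} (h : f =ᵐ[μ] g) :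
    orliczModular Φ μ f = orliczModular Φ μ g :=
  lintegral_congr_ae (h.mono fun x hx => by simp [hx])

lemma gaugeNorm_congr {f g : X → ℝ} (h : f =ᵐ[μ] g) : gaugeNorm Φ μ f = gaugeNorm Φ μ g := by
  unfold gaugeNorm
  congr 1
  ext k
  rw [Set.mem_ofPred_eq, Set.mem_ofPred_eq,
    orliczModular_congr Φ μ (f := fun x => f x / k) (g := fun x => g x / k)
      (h.mono fun x hx => by simp [hx])]

lemma orliczModular_mono {f g : X → ℝ} (h : ∀ x, |f x| ≤ |g x|) :
    orliczModular Φ μ f ≤ orliczModular Φ μ g := by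
  refine lintegral_mono fun x => ?_
  rw [← Φ.map_abs (f x), ← Φ.map_abs (g x)]
  exact Φ.mono (abs_nonneg _) (h x)

lemma orliczModular_smul_le (t : ℝ≥0) (ht : t ≤ 1) (f : X → ℝ) :
    orliczModular Φ μ (fun x => (t : ℝ) * f x) ≤ t * orliczModular Φ μ f := by
  unfold orliczModular
  rw [← lintegral_const_mul' _ _ ENNReal.coe_ne_top]
  exact lintegral_mono fun x => Φ.smul_le t ht _

lemma orliczModular_convex {f g : X → ℝ} (hf : AEMeasurable f μ) (s t : ℝ≥0) (hst : s + t = 1) :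
    orliczModular Φ μ (fun x => (s : ℝ) * f x + (t : ℝ) * g x) ≤
      s * orliczModular Φ μ f + t * orliczModular Φ μ g := by
  unfold orliczModular
  rw [← lintegral_const_mul' _ _ ENNReal.coe_ne_top,
    ← lintegral_const_mul' (t : ℝ≥0∞) _ ENNReal.coe_ne_top,
    ← lintegral_add_left' (f := fun x => (s : ℝ≥0∞) * Φ (f x))
      ((Φ.measurable.comp_aemeasurable hf).const_mul _)]
  refine lintegral_mono fun x => ?_
  have h : Φ (s • f x + t • g x) ≤ s • Φ (f x) + t • Φ (g x) :=
    Φ.convex.2 (Set.mem_univ (f x)) (Set.mem_univ (g x)) zero_le zero_le hst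
  simpa [NNReal.smul_def, ENNReal.smul_def] using h

lemma gaugeNorm_nonneg (f : X → ℝ) : 0 ≤ gaugeNorm Φ μ f :=
  Real.sInf_nonneg fun _ hk => hk.1.le

lemma gaugeNorm_le {f : X → ℝ} {k : ℝ} (hk : 0 < k)
    (h : orliczModular Φ μ (fun x => f x / k) ≤ 1) : gaugeNorm Φ μ f ≤ k :=
  csInf_le ⟨0, fun _ hk => hk.1.le⟩ ⟨hk, h⟩

lemma gaugeSet_nonempty {f : X → ℝ}
    (h : ∃ k : ℝ, 0 < k ∧ orliczModular Φ μ (fun x => k * f x) < ∞) :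
    {k : ℝ | 0 < k ∧ orliczModular Φ μ (fun x => f x / k) ≤ 1}.Nonempty := by
  obtain ⟨k, hk, hfin⟩ := h
  set m : ℝ≥0 := (orliczModular Φ μ (fun x => k * f x)).toNNReal with hm
  have hm' : orliczModular Φ μ (fun x => k * f x) = m := (ENNReal.coe_toNNReal hfin.ne).symm
  set t : ℝ≥0 := (1 + m)⁻¹ with ht
  have ht0 : 0 < t := by positivity
  have ht1 : t ≤ 1 := inv_le_one_of_one_le₀ (by simp)
  refine ⟨((t : ℝ) * k)⁻¹, by positivity, ?_⟩
  have e : (fun x => f x / ((t : ℝ) * k)⁻¹) = fun x => (t : ℝ) * (k * f x) := by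
    funext x; rw [div_inv_eq_mul]; ring
  rw [e]
  refine (orliczModular_smul_le Φ μ t ht1 _).trans ?_
  rw [hm']
  have : t * m ≤ 1 := by
    rw [ht, inv_mul_le_iff₀ (by positivity)]; simp
  exact_mod_cast this

lemma modular_le_one_of_gaugeNorm_lt {f : X → ℝ} {a : ℝ}
    (h : ∃ k : ℝ, 0 < k ∧ orliczModular Φ μ (fun x => k * f x) < ∞)
    (ha : gaugeNorm Φ μ f < a) : orliczModular Φ μ (fun x => f x / a) ≤ 1 := by
  obtain ⟨k, ⟨hk, hk1⟩, hka⟩ := exists_lt_of_csInf_lt (gaugeSet_nonempty Φ μ h) ha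
  refine (orliczModular_mono Φ μ fun x => ?_).trans hk1
  rw [abs_div, abs_div, abs_of_pos hk, abs_of_pos (hk.trans hka)]
  gcongr

end Modular

/-- The Orlicz space `L^Φ(μ)` of (classes of) measurable functions `f : X → ℝ` with
`ρ_Φ(k f) < ∞` for some `k > 0`. -/
def OrliczSpace (Φ : YoungFunction) (μ : Measure X) : Submodule ℝ (X →ₘ[μ] ℝ) where
  carrier := {f | ∃ k : ℝ, 0 < k ∧ orliczModular Φ μ (fun x => k * f x) < ∞}
  zero_mem' := by
    refine ⟨1, one_pos, ?_⟩
    rw [orliczModular_congr Φ μ (g := fun _ => 0)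
      ((AEEqFun.coeFn_zero (α := X) (β := ℝ) (μ := μ)).mono fun x hx => by simp [hx])]
    simp [orliczModular, Φ.map_zero]
  add_mem' := by
    rintro f g ⟨a, ha, hfa⟩ ⟨b, hb, hgb⟩
    have hc : 0 < min a b := lt_min ha hb
    refine ⟨min a b / 2, by positivity, ?_⟩
    have e : orliczModular Φ μ (fun x => min a b / 2 * (f + g : X →ₘ[μ] ℝ) x) =
        orliczModular Φ μ (fun x => ((1 / 2 : ℝ≥0) : ℝ) * (min a b * f x) +
          ((1 / 2 : ℝ≥0) : ℝ) * (min a b * g x)) :=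
      orliczModular_congr Φ μ ((AEEqFun.coeFn_add f g).mono fun x hx => by
        simp only [hx, Pi.add_apply]; push_cast; ring)
    rw [e]
    refine (orliczModular_convex Φ μ (f.aestronglyMeasurable.aemeasurable.const_mul _) _ _
      (add_halves 1)).trans_lt ?_
    have h1 : orliczModular Φ μ (fun x => min a b * f x) < ∞ :=
      (orliczModular_mono Φ μ fun x => by
        rw [abs_mul, abs_mul, abs_of_pos hc, abs_of_pos ha]; gcongr; simp).trans_lt hfa
    have h2 : orliczModular Φ μ (fun x => min a b * g x) < ∞ :=
      (orliczModular_mono Φ μ fun x => by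
        rw [abs_mul, abs_mul, abs_of_pos hc, abs_of_pos hb]; gcongr; simp).trans_lt hgb
    exact ENNReal.add_lt_top.2
      ⟨ENNReal.mul_lt_top ENNReal.coe_lt_top h1, ENNReal.mul_lt_top ENNReal.coe_lt_top h2⟩
  smul_mem' := by
    rintro c f ⟨a, ha, hfa⟩
    have hc : 0 < |c| + 1 := by positivity
    refine ⟨a / (|c| + 1), by positivity, ?_⟩
    rw [orliczModular_congr Φ μ (g := fun x => a / (|c| + 1) * (c * f x))
      ((AEEqFun.coeFn_smul c f).mono fun x hx => by simp [hx])]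
    refine (orliczModular_mono Φ μ fun x => ?_).trans_lt hfa
    have e : a / (|c| + 1) * (c * f x) = (c / (|c| + 1)) * (a * f x) := by ring
    rw [e, abs_mul (c / (|c| + 1))]
    refine mul_le_of_le_one_left (abs_nonneg _) ?_
    rw [abs_div, abs_of_pos hc, div_le_one hc]
    linarith

section Space

variable (Φ : YoungFunction) (μ : Measure X)

instance OrliczSpace.instNorm : Norm (OrliczSpace Φ μ) := ⟨fun f => gaugeNorm Φ μ (f : X →ₘ[μ] ℝ)⟩

lemma OrliczSpace.norm_def (f : OrliczSpace Φ μ) : ‖f‖ = gaugeNorm Φ μ (f : X →ₘ[μ] ℝ) := rfl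

lemma gaugeNorm_add_le (f g : OrliczSpace Φ μ) : ‖f + g‖ ≤ ‖f‖ + ‖g‖ := by
  refine le_of_forall_pos_le_add fun ε hε => ?_
  have hf0 := gaugeNorm_nonneg Φ μ (f : X →ₘ[μ] ℝ)
  have hg0 := gaugeNorm_nonneg Φ μ (g : X →ₘ[μ] ℝ)
  simp only [OrliczSpace.norm_def] at *
  set a := gaugeNorm Φ μ (f : X →ₘ[μ] ℝ) + ε / 2 with ha
  set b := gaugeNorm Φ μ (g : X →ₘ[μ] ℝ) + ε / 2 with hb
  have ha0 : 0 < a := by positivity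
  have hb0 : 0 < b := by positivity
  have h1 := modular_le_one_of_gaugeNorm_lt Φ μ (a := a) f.2 (by linarith)
  have h2 := modular_le_one_of_gaugeNorm_lt Φ μ (a := b) g.2 (by linarith)
  have hab : 0 < a + b := by positivity
  have hle : gaugeNorm Φ μ ((f + g : OrliczSpace Φ μ) : X →ₘ[μ] ℝ) ≤ a + b := by
    refine gaugeNorm_le Φ μ hab ?_
    set s : ℝ≥0 := ⟨a / (a + b), by positivity⟩
    set t : ℝ≥0 := ⟨b / (a + b), by positivity⟩
    have hst : s + t = 1 := by
      rw [← NNReal.coe_inj]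
      change a / (a + b) + b / (a + b) = 1
      field_simp
    have e : orliczModular Φ μ (fun x => ((f + g : OrliczSpace Φ μ) : X →ₘ[μ] ℝ) x / (a + b)) =
        orliczModular Φ μ (fun x => (s : ℝ) * ((f : X →ₘ[μ] ℝ) x / a) +
          (t : ℝ) * ((g : X →ₘ[μ] ℝ) x / b)) :=
      orliczModular_congr Φ μ ((AEEqFun.coeFn_add (f : X →ₘ[μ] ℝ) (g : X →ₘ[μ] ℝ)).mono
        fun x hx => by
          change ((f : X →ₘ[μ] ℝ) + (g : X →ₘ[μ] ℝ) : X →ₘ[μ] ℝ) x / (a + b) =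
            a / (a + b) * ((f : X →ₘ[μ] ℝ) x / a) + b / (a + b) * ((g : X →ₘ[μ] ℝ) x / b)
          rw [hx, Pi.add_apply]
          field_simp)
    rw [e]
    refine (orliczModular_convex Φ μ
      ((f : X →ₘ[μ] ℝ).aestronglyMeasurable.aemeasurable.div_const _) s t hst).trans ?_
    calc _ ≤ (s : ℝ≥0∞) * 1 + t * 1 := by gcongr
      _ = 1 := by rw [mul_one, mul_one]; exact_mod_cast hst
  linarith

lemma gaugeNorm_smul_le (c : ℝ) (hc : c ≠ 0) (f : OrliczSpace Φ μ) : ‖c • f‖ ≤ |c| * ‖f‖ := by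
  have hc0 : 0 < |c| := abs_pos.2 hc
  refine le_of_forall_pos_le_add fun ε hε => ?_
  have hf0 := gaugeNorm_nonneg Φ μ (f : X →ₘ[μ] ℝ)
  simp only [OrliczSpace.norm_def] at *
  set a := gaugeNorm Φ μ (f : X →ₘ[μ] ℝ) + ε / |c| with ha
  have ha0 : 0 < a := by positivity
  have h1 := modular_le_one_of_gaugeNorm_lt Φ μ (a := a) f.2 (by linarith [div_pos hε hc0])
  have : gaugeNorm Φ μ ((c • f : OrliczSpace Φ μ) : X →ₘ[μ] ℝ) ≤ |c| * a := by
    refine gaugeNorm_le Φ μ (by positivity) (le_trans ?_ h1)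
    rw [orliczModular_congr Φ μ (g := fun x => c * (f : X →ₘ[μ] ℝ) x / (|c| * a))
      ((AEEqFun.coeFn_smul c (f : X →ₘ[μ] ℝ)).mono fun x hx => by
        change (c • (f : X →ₘ[μ] ℝ) : X →ₘ[μ] ℝ) x / _ = _
        rw [hx]; rfl)]
    refine orliczModular_mono Φ μ fun x => le_of_eq ?_
    rw [abs_div, abs_mul, abs_mul, abs_abs, abs_div]
    field_simp
  calc _ ≤ |c| * a := this
    _ = |c| * gaugeNorm Φ μ (f : X →ₘ[μ] ℝ) + ε := by rw [ha]; field_simp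

lemma gaugeNorm_eq_zero (f : OrliczSpace Φ μ) (h : ‖f‖ = 0) : f = 0 := by
  rw [OrliczSpace.norm_def] at h
  have hmod : ∀ k : ℝ, 0 < k → orliczModular Φ μ (fun x => (f : X →ₘ[μ] ℝ) x / k) ≤ 1 :=
    fun k hk => modular_le_one_of_gaugeNorm_lt Φ μ f.2 (by rwa [h])
  have key : ∀ δ : ℝ, 0 < δ → μ {x | δ ≤ |(f : X →ₘ[μ] ℝ) x|} = 0 := by
    intro δ hδ
    by_contra hne
    set m := μ {x | δ ≤ |(f : X →ₘ[μ] ℝ) x|} with hm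
    have hlt : m⁻¹ < ∞ := ENNReal.inv_lt_top.2 (pos_iff_ne_zero.2 hne)
    obtain ⟨r, hr, hr0⟩ := ((Φ.tendsto_top.eventually (lt_mem_nhds hlt)).and
      (eventually_gt_atTop 0)).exists
    have h1 := hmod (δ / r) (by positivity)
    have h2 : Φ r * m ≤ 1 := by
      refine le_trans ?_ h1
      calc Φ r * m ≤ Φ r * μ {x | Φ r ≤ Φ ((f : X →ₘ[μ] ℝ) x / (δ / r))} := by
            gcongr
            refine measure_mono fun x hx => ?_
            change Φ r ≤ Φ _
            rw [← Φ.map_abs (_ / _)]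
            refine Φ.mono hr0.le ?_
            rw [abs_div, abs_of_pos (by positivity : 0 < δ / r), le_div_iff₀ (by positivity)]
            rw [mul_div_cancel₀ _ hr0.ne']
            exact hx
        _ ≤ _ := mul_meas_ge_le_lintegral₀ (Φ.measurable.comp_aemeasurable
            ((f : X →ₘ[μ] ℝ).aestronglyMeasurable.aemeasurable.div_const _)) _
    have hmtop : m ≠ ∞ := by
      intro htop
      rw [htop, ENNReal.mul_top ((zero_le).trans_lt hr).ne'] at h2
      exact absurd h2 (by simp)
    have h3 : 1 < Φ r * m := by
      calc (1 : ℝ≥0∞) = m⁻¹ * m := (ENNReal.inv_mul_cancel hne hmtop).symm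
        _ < Φ r * m := ENNReal.mul_lt_mul_left hne hmtop hr
    exact absurd h2 (not_le.2 h3)
  have hae : ∀ᵐ x ∂μ, (f : X →ₘ[μ] ℝ) x = 0 := by
    have hall : ∀ᵐ x ∂μ, ∀ n : ℕ, ¬ (1 / ((n : ℝ) + 1) ≤ |(f : X →ₘ[μ] ℝ) x|) :=
      ae_all_iff.2 fun n => by
        rw [ae_iff]; simpa using key (1 / ((n : ℝ) + 1)) (by positivity)
    filter_upwards [hall] with x hx
    by_contra hne
    obtain ⟨n, hn⟩ := exists_nat_one_div_lt (abs_pos.2 hne)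
    exact hx n hn.le
  apply Subtype.ext
  refine AEEqFun.ext ?_
  filter_upwards [hae, AEEqFun.coeFn_zero (α := X) (β := ℝ) (μ := μ)] with x hx h0
  rw [hx]
  exact h0.symm

lemma gaugeNorm_zero : ‖(0 : OrliczSpace Φ μ)‖ = 0 := by
  refine le_antisymm (le_of_forall_pos_le_add fun ε hε => ?_) (gaugeNorm_nonneg _ _ _)
  rw [zero_add]
  refine gaugeNorm_le Φ μ hε ?_
  rw [orliczModular_congr Φ μ (g := fun _ => 0)
    ((AEEqFun.coeFn_zero (α := X) (β := ℝ) (μ := μ)).mono fun x hx => by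
      change (0 : X →ₘ[μ] ℝ) x / ε = 0
      rw [hx]; simp)]
  simp [orliczModular, Φ.map_zero]

lemma OrliczSpace.core : NormedSpace.Core ℝ (OrliczSpace Φ μ) where
  norm_nonneg f := gaugeNorm_nonneg _ _ _
  norm_smul c f := by
    rcases eq_or_ne c 0 with rfl | hc
    · simp [gaugeNorm_zero]
    refine le_antisymm (gaugeNorm_smul_le Φ μ c hc f) ?_
    have h := gaugeNorm_smul_le Φ μ c⁻¹ (inv_ne_zero hc) (c • f)
    rw [inv_smul_smul₀ hc, abs_inv, inv_mul_eq_div, le_div_iff₀ (abs_pos.2 hc)] at h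
    rw [Real.norm_eq_abs, mul_comm]
    exact h
  norm_triangle := gaugeNorm_add_le Φ μ
  norm_eq_zero_iff f := ⟨gaugeNorm_eq_zero Φ μ f, by rintro rfl; exact gaugeNorm_zero Φ μ⟩

instance OrliczSpace.instNormedAddCommGroup : NormedAddCommGroup (OrliczSpace Φ μ) :=
  NormedAddCommGroup.ofCore (OrliczSpace.core Φ μ)

instance OrliczSpace.instNormedSpace : NormedSpace ℝ (OrliczSpace Φ μ) :=
  NormedSpace.ofCore (OrliczSpace.core Φ μ)

end Space

/-- `φ` is an invertible bimeasurable transformation for which there is `c > 0` with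
`μ(φ⁻¹ A) ≤ c μ(A)` for every measurable `A`. -/
structure IsCompositionSystem (μ : Measure X) (φ : Equiv.Perm X) : Prop where
  measurable : Measurable φ
  measurable_symm : Measurable φ.symm
  bound : ∃ c : ℝ≥0, 0 < c ∧ ∀ A : Set X, MeasurableSet A → μ (φ ⁻¹' A) ≤ c * μ A

namespace IsCompositionSystem

variable {μ : Measure X} {φ : Equiv.Perm X}

lemma map_le (h : IsCompositionSystem μ φ) : ∃ c : ℝ≥0, 1 ≤ c ∧ μ.map φ ≤ (c : ℝ≥0∞) • μ := by
  obtain ⟨c, -, hc⟩ := h.bound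
  refine ⟨max c 1, le_max_right _ _, Measure.le_iff.2 fun A hA => ?_⟩
  rw [Measure.map_apply h.measurable hA, Measure.smul_apply, smul_eq_mul]
  refine (hc A hA).trans ?_
  gcongr
  exact le_max_left _ _

lemma quasi (h : IsCompositionSystem μ φ) : Measure.QuasiMeasurePreserving φ μ μ := by
  obtain ⟨c, -, hc⟩ := h.map_le
  exact ⟨h.measurable, (Measure.absolutelyContinuous_of_le hc).trans
    (Measure.smul_absolutelyContinuous)⟩

lemma modular_comp_le (h : IsCompositionSystem μ φ) (Φ : YoungFunction) :
    ∃ c : ℝ≥0, 1 ≤ c ∧ ∀ (f : X →ₘ[μ] ℝ) (a : ℝ),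
      orliczModular Φ μ (fun x => a * (f.compQuasiMeasurePreserving φ h.quasi) x) ≤
        c * orliczModular Φ μ (fun x => a * f x) := by
  obtain ⟨c, hc1, hc⟩ := h.map_le
  refine ⟨c, hc1, fun f a => ?_⟩
  rw [orliczModular_congr Φ μ (g := fun x => a * f (φ x))
    ((AEEqFun.coeFn_compQuasiMeasurePreserving f h.quasi).mono fun x hx => by simp [hx])]
  unfold orliczModular
  have hm : Measurable fun x => Φ (a * f x) :=
    Φ.measurable.comp (f.stronglyMeasurable.measurable.const_mul a)
  calc ∫⁻ x, Φ (a * f (φ x)) ∂μ = ∫⁻ x, Φ (a * f x) ∂(μ.map φ) :=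
        (lintegral_map hm h.measurable).symm
    _ ≤ ∫⁻ x, Φ (a * f x) ∂((c : ℝ≥0∞) • μ) := lintegral_mono' hc le_rfl
    _ = c * ∫⁻ x, Φ (a * f x) ∂μ := by rw [lintegral_smul_measure, smul_eq_mul]

/-- Composition with `φ` as a linear map of `L^Φ(μ)`. -/
def compLinear (h : IsCompositionSystem μ φ) (Φ : YoungFunction) :
    OrliczSpace Φ μ →ₗ[ℝ] OrliczSpace Φ μ where
  toFun f := ⟨(f : X →ₘ[μ] ℝ).compQuasiMeasurePreserving φ h.quasi, by
    obtain ⟨c, -, hc⟩ := h.modular_comp_le Φ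
    obtain ⟨k, hk, hkf⟩ := f.2
    exact ⟨k, hk, (hc f k).trans_lt (ENNReal.mul_lt_top ENNReal.coe_lt_top hkf)⟩⟩
  map_add' f g := by
    have key : ∀ a b : X →ₘ[μ] ℝ, (a + b).compQuasiMeasurePreserving φ h.quasi =
        a.compQuasiMeasurePreserving φ h.quasi + b.compQuasiMeasurePreserving φ h.quasi :=
      fun a b => AEEqFun.induction_on₂ a b fun _ _ _ _ => rfl
    exact Subtype.ext (key f g)
  map_smul' r f := by
    have key : ∀ a : X →ₘ[μ] ℝ, (r • a).compQuasiMeasurePreserving φ h.quasi =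
        r • a.compQuasiMeasurePreserving φ h.quasi :=
      fun a => AEEqFun.induction_on a fun _ _ => rfl
    exact Subtype.ext (key f)

lemma compLinear_bound (h : IsCompositionSystem μ φ) (Φ : YoungFunction) :
    ∃ c : ℝ, ∀ f : OrliczSpace Φ μ, ‖h.compLinear Φ f‖ ≤ c * ‖f‖ := by
  obtain ⟨c, hc1, hc⟩ := h.modular_comp_le Φ
  have hc0 : (0 : ℝ) < c := by exact_mod_cast zero_lt_one.trans_le hc1
  refine ⟨c, fun f => le_of_forall_pos_le_add fun ε hε => ?_⟩
  have hf0 := gaugeNorm_nonneg Φ μ (f : X →ₘ[μ] ℝ)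
  set a := gaugeNorm Φ μ (f : X →ₘ[μ] ℝ) + ε / c with ha
  have ha0 : 0 < a := by positivity
  have h1 := modular_le_one_of_gaugeNorm_lt Φ μ (a := a) f.2 (by linarith [div_pos hε hc0])
  have hle : gaugeNorm Φ μ ((h.compLinear Φ f : OrliczSpace Φ μ) : X →ₘ[μ] ℝ) ≤ c * a := by
    refine gaugeNorm_le Φ μ (by positivity) ?_
    have e : (fun x => ((h.compLinear Φ f : OrliczSpace Φ μ) : X →ₘ[μ] ℝ) x / (c * a)) =
        fun x => ((c⁻¹ : ℝ≥0) : ℝ) *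
          (a⁻¹ * ((f : X →ₘ[μ] ℝ).compQuasiMeasurePreserving φ h.quasi) x) := by
      funext x
      change (((f : X →ₘ[μ] ℝ).compQuasiMeasurePreserving φ h.quasi) x) / (c * a) = _
      push_cast
      field_simp
    rw [e]
    refine (orliczModular_smul_le Φ μ _ (inv_le_one_of_one_le₀ hc1) _).trans ?_
    calc _ ≤ ((c⁻¹ : ℝ≥0) : ℝ≥0∞) *
          (c * orliczModular Φ μ (fun x => a⁻¹ * (f : X →ₘ[μ] ℝ) x)) := by
          gcongr; exact hc _ _
      _ = orliczModular Φ μ (fun x => (f : X →ₘ[μ] ℝ) x / a) := by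
          rw [← mul_assoc, ← ENNReal.coe_mul, inv_mul_cancel₀ (zero_lt_one.trans_le hc1).ne',
            ENNReal.coe_one, one_mul]
          simp only [div_eq_inv_mul]
      _ ≤ 1 := h1
  calc _ ≤ (c : ℝ) * a := hle
    _ = c * gaugeNorm Φ μ (f : X →ₘ[μ] ℝ) + ε := by rw [ha]; field_simp

/-- The composition operator `C_φ f = f ∘ φ`, a bounded linear operator on `L^Φ(μ)`. -/
def compositionOperator (h : IsCompositionSystem μ φ) (Φ : YoungFunction) :
    OrliczSpace Φ μ →L[ℝ] OrliczSpace Φ μ :=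
  (h.compLinear Φ).mkContinuousOfExistsBound (h.compLinear_bound Φ)

lemma compositionOperator_ae (h : IsCompositionSystem μ φ) (Φ : YoungFunction)
    (f : OrliczSpace Φ μ) :
    ((h.compositionOperator Φ f : OrliczSpace Φ μ) : X →ₘ[μ] ℝ) =ᵐ[μ]
      (f : X →ₘ[μ] ℝ) ∘ φ :=
  AEEqFun.coeFn_compQuasiMeasurePreserving _ h.quasi

end IsCompositionSystem

/-- The system is dissipative, generated by `W`: `W` is measurable, `0 < μ(W) < ∞`, and `X` is the
disjoint union of the sets `φᵏ(W)`, `k ∈ ℤ`. -/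
structure IsDissipative (μ : Measure X) (φ : Equiv.Perm X) (W : Set X) : Prop where
  measurableSet : MeasurableSet W
  pos : 0 < μ W
  lt_top : μ W < ∞
  iUnion_eq : ⋃ k : ℤ, (φ ^ k : Equiv.Perm X) '' W = Set.univ
  disjoint : Pairwise fun j k : ℤ =>
    Disjoint ((φ ^ j : Equiv.Perm X) '' W) ((φ ^ k : Equiv.Perm X) '' W)

/-- The gauge norm `N_Φ(C_φᵏ χ_F)` of `C_φᵏ χ_F = χ_F ∘ φᵏ`, `k ∈ ℤ`. -/
def indicatorNorm (Φ : YoungFunction) (μ : Measure X) (φ : Equiv.Perm X) (k : ℤ) (F : Set X) : ℝ :=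
  gaugeNorm Φ μ (fun x => F.indicator (fun _ => (1 : ℝ)) ((φ ^ k : Equiv.Perm X) x))

/-- Bounded distortion on `W`, with respect to the gauge norm. The quotients are meant for sets
`F ⊆ W` of positive measure. -/
def HasBoundedDistortion (Φ : YoungFunction) (μ : Measure X) (φ : Equiv.Perm X) (W : Set X) :
    Prop :=
  ∃ K : ℝ, 0 < K ∧ ∀ (k : ℤ) (F : Set X), MeasurableSet F → F ⊆ W → 0 < μ F →
    1 / K * (indicatorNorm Φ μ φ k W / indicatorNorm Φ μ φ 0 W) ≤
        indicatorNorm Φ μ φ k F / indicatorNorm Φ μ φ 0 F ∧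
      indicatorNorm Φ μ φ k F / indicatorNorm Φ μ φ 0 F ≤
        K * (indicatorNorm Φ μ φ k W / indicatorNorm Φ μ φ 0 W)

/-- The number `Φ⁻¹(1 / μ(φᵏ(W)))`. -/
def orbitInverse (Φ : YoungFunction) (μ : Measure X) (φ : Equiv.Perm X) (W : Set X) (k : ℤ) :
    ℝ≥0∞ :=
  Φ.inverse (1 / μ ((φ ^ k : Equiv.Perm X) '' W))

/-- A bounded operator `T` on a normed space is strongly structurally stable if it is invertible
and for every `ε > 0` there is `δ > 0` such that for every Lipschitz map `α` with `‖α‖_∞ ≤ δ` and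
Lipschitz constant at most `δ` there is a homeomorphism `h` of the space with
`h ∘ T = (T + α) ∘ h` and `‖h - I‖_∞ ≤ ε`. -/
def IsStronglyStructurallyStable {E : Type*} [NormedAddCommGroup E] [NormedSpace ℝ E]
    (T : E →L[ℝ] E) : Prop :=
  IsUnit T ∧ ∀ ε : ℝ, 0 < ε → ∃ δ : ℝ≥0, 0 < δ ∧ ∀ α : E → E,
    LipschitzWith δ α → (∀ x, ‖α x‖ ≤ δ) →
      ∃ h : E ≃ₜ E, (∀ x, h (T x) = T (h x) + α (h x)) ∧ ∀ x, ‖h x - x‖ ≤ ε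

end

/-!
If `∑ₖ A k` is an absolutely summable Green kernel of the equation `x (k + 1) = T (x k) + y k`, then
along every homeomorphism `S` the operator `g ↦ g ∘ S - T ∘ g` on bounded continuous maps has a
right inverse of norm at most `∑ₖ ‖A k‖`. A conjugacy `1 + g` between `T` and `T + α` is then a
fixed point of a contraction, in either direction, and uniqueness of fixed points shows that the two
conjugacies are inverse to each other. Generalized hyperbolic operators, which contract the range of
a projection while their inverses contract its kernel, have such a kernel.

For `C_φ` the projection is multiplication by the indicator function of a union of levels `φᵏ(W)`.
The gauge norm of `χ_A` is `1 / Φ⁻¹(1 / μ(A))`, so the hypotheses are rates of decay of the gauge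
norms of the levels. By bounded distortion and convexity, `φⁿ` then contracts `μ` there by an
arbitrarily small factor; the same decay, along a single orbit, forces `Φ` to satisfy a doubling
condition at the scales in question, and the two together make a power of the composition operator
a contraction.
-/

section StructuralStability

open scoped BoundedContinuousFunction

lemma semiconj_homeomorph_zpow {Y Z : Type*} [TopologicalSpace Y] [TopologicalSpace Z]
    {h : Y → Z} {S₁ : Y ≃ₜ Y} {S₂ : Z ≃ₜ Z} (hS : Function.Semiconj h S₁ S₂) (k : ℤ) :
    Function.Semiconj h (S₁ ^ k : Y ≃ₜ Y) (S₂ ^ k : Z ≃ₜ Z) := by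
  have hinv : Function.Semiconj h S₁.symm S₂.symm :=
    hS.inverses_right S₁.apply_symm_apply S₂.symm_apply_apply
  induction k with
  | zero => exact fun _ => rfl
  | succ n ih =>
    rw [zpow_add_one, zpow_add_one]
    exact ih.comp_right hS
  | pred n ih =>
    rw [zpow_sub_one, zpow_sub_one]
    exact ih.comp_right hinv

variable {E : Type*} [NormedAddCommGroup E]

/-- The map `x ↦ x + g x`. -/
def displace (g : E →ᵇ E) : C(E, E) :=
  ContinuousMap.id E + g.toContinuousMap

lemma displace_apply (g : E →ᵇ E) (x : E) : displace g x = x + g x := rfl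

variable [NormedSpace ℝ E]

/-- A summable Green kernel for the two-sided difference equation `x (k + 1) = T (x k) + y k`. Its
convolution with a bounded sequence `y` is a bounded solution `x`. -/
structure IsGreenKernel (T : E →L[ℝ] E) (A : ℤ → E →L[ℝ] E) : Prop where
  summable_norm : Summable fun k => ‖A k‖
  recurrence : ∀ k, A (k - 1) - T ∘L A k = if k = 0 then 1 else 0

/-- The sum `∑ₖ A k ∘ β ∘ S ^ k` of a bounded continuous map along the orbits of `S`, weighted by
the operators `A k`. -/
noncomputable def orbitSum (A : ℤ → E →L[ℝ] E) (S : E ≃ₜ E) (β : E →ᵇ E) : E →ᵇ E :=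
  ∑' k, (A k).compLeftContinuousBounded E (β.compContinuous (S ^ k : E ≃ₜ E))

section orbitSum

variable {A : ℤ → E →L[ℝ] E} {S : E ≃ₜ E}

lemma norm_orbitSum_term_le (β : E →ᵇ E) (k : ℤ) :
    ‖(A k).compLeftContinuousBounded E (β.compContinuous (S ^ k : E ≃ₜ E))‖ ≤ ‖A k‖ * ‖β‖ :=
  (BoundedContinuousFunction.norm_le (by positivity)).2 fun _ =>
    (A k).le_opNorm_of_le (β.norm_coe_le_norm _)

lemma norm_orbitSum_le (hA : Summable fun k => ‖A k‖) (β : E →ᵇ E) :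
    ‖orbitSum A S β‖ ≤ (∑' k, ‖A k‖) * ‖β‖ :=
  tsum_of_norm_bounded (hA.hasSum.mul_right _) (norm_orbitSum_term_le β)

variable [CompleteSpace E]

lemma hasSum_orbitSum (hA : Summable fun k => ‖A k‖) (β : E →ᵇ E) :
    HasSum (fun k => (A k).compLeftContinuousBounded E (β.compContinuous (S ^ k : E ≃ₜ E)))
      (orbitSum A S β) :=
  (Summable.of_norm_bounded (hA.mul_right _) (norm_orbitSum_term_le β)).hasSum

lemma hasSum_orbitSum_apply (hA : Summable fun k => ‖A k‖) (β : E →ᵇ E) (x : E) :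
    HasSum (fun k => A k (β ((S ^ k : E ≃ₜ E) x))) (orbitSum A S β x) :=
  (hasSum_orbitSum hA β).mapL (BoundedContinuousFunction.evalCLM ℝ x)

lemma orbitSum_add (hA : Summable fun k => ‖A k‖) (β γ : E →ᵇ E) :
    orbitSum A S (β + γ) = orbitSum A S β + orbitSum A S γ := by
  ext x
  refine (hasSum_orbitSum_apply hA _ x).unique ?_
  simpa using (hasSum_orbitSum_apply hA β x).add (hasSum_orbitSum_apply hA γ x)

lemma orbitSum_sub (hA : Summable fun k => ‖A k‖) (β γ : E →ᵇ E) :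
    orbitSum A S (β - γ) = orbitSum A S β - orbitSum A S γ :=
  eq_sub_of_add_eq (by rw [← orbitSum_add hA, sub_add_cancel])

lemma orbitSum_compContinuous (hA : Summable fun k => ‖A k‖) {S' : E ≃ₜ E} (h : C(E, E))
    (hS : Function.Semiconj h S S') (β : E →ᵇ E) :
    orbitSum A S (β.compContinuous h) = (orbitSum A S' β).compContinuous h := by
  ext x
  refine (hasSum_orbitSum_apply hA _ x).unique ?_
  simpa only [BoundedContinuousFunction.compContinuous_apply,
    (semiconj_homeomorph_zpow hS _).eq] using hasSum_orbitSum_apply hA β (h x)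

end orbitSum

namespace IsGreenKernel

variable [CompleteSpace E] {T : E →L[ℝ] E} {A : ℤ → E →L[ℝ] E} {S S₁ S₂ : E ≃ₜ E}
  {α₁ α₂ g₁ g₂ : E →ᵇ E} {K : ℝ≥0}

lemma orbitSum_apply_sub (hA : IsGreenKernel T A) (β : E →ᵇ E) (x : E) :
    orbitSum A S β (S x) - T (orbitSum A S β x) = β x := by
  have hx := hasSum_orbitSum_apply (S := S) hA.summable_norm β x
  have hSx : HasSum (fun k => A (k - 1) (β ((S ^ k : E ≃ₜ E) x))) (orbitSum A S β (S x)) := by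
    rw [← (Equiv.addRight (1 : ℤ)).hasSum_iff]
    convert hasSum_orbitSum_apply hA.summable_norm β (S x) using 3 with k
    simp [zpow_add_one]
  refine (hSx.sub (hx.mapL T)).unique ?_
  convert hasSum_ite_eq (0 : ℤ) (β x) using 2 with k
  have hk := DFunLike.congr_fun (hA.recurrence k) (β ((S ^ k : E ≃ₜ E) x))
  split_ifs at hk ⊢ with h0
  · simpa [h0] using hk
  · simpa using hk

lemma norm_orbitSum_sub_le (hA : IsGreenKernel T A) (hα : LipschitzWith K α₂) (f g : C(E, E))
    {C : ℝ} (hC : ∀ x, ‖f x - g x‖ ≤ C) :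
    ‖orbitSum A S (α₂.compContinuous f) - orbitSum A S (α₂.compContinuous g)‖ ≤
      (∑' k, ‖A k‖) * K * C := by
  have hC0 : 0 ≤ C := (norm_nonneg _).trans (hC 0)
  rw [← orbitSum_sub hA.summable_norm, mul_assoc]
  refine (norm_orbitSum_le hA.summable_norm _).trans ?_
  gcongr
  refine (BoundedContinuousFunction.norm_le (by positivity)).2 fun x => ?_
  exact (hα.norm_sub_le _ _).trans (by gcongr; exact hC x)

lemma exists_eq_orbitSum_displace (hA : IsGreenKernel T A) (hα : LipschitzWith K α₂)
    (hK : (∑' k, ‖A k‖) * K < 1) (S : E ≃ₜ E) (α₁ : E →ᵇ E) :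
    ∃ g : E →ᵇ E, g = orbitSum A S (α₂.compContinuous (displace g) - α₁) := by
  have hK0 : 0 ≤ (∑' k, ‖A k‖) * K := mul_nonneg (tsum_nonneg fun _ => norm_nonneg _) K.2
  have hF : ContractingWith ⟨_, hK0⟩
      fun g : E →ᵇ E => orbitSum A S (α₂.compContinuous (displace g) - α₁) := by
    refine ⟨hK, LipschitzWith.of_dist_le_mul fun g₁ g₂ => ?_⟩
    rw [dist_eq_norm, dist_eq_norm, orbitSum_sub hA.summable_norm, orbitSum_sub hA.summable_norm,
      sub_sub_sub_cancel_right]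
    refine hA.norm_orbitSum_sub_le hα _ _ fun x => ?_
    rw [displace_apply, displace_apply, add_sub_add_left_eq_sub]
    exact (g₁ - g₂).norm_coe_le_norm x
  exact ⟨_, hF.fixedPoint_isFixedPt.symm⟩

lemma semiconj_displace (hA : IsGreenKernel T A) (hS₁ : ∀ x, S₁ x = T x + α₁ x)
    (hS₂ : ∀ x, S₂ x = T x + α₂ x)
    (hg : g₁ = orbitSum A S₁ (α₂.compContinuous (displace g₁) - α₁)) :
    Function.Semiconj (displace g₁) S₁ S₂ := fun x => by
  have hx := hA.orbitSum_apply_sub (S := S₁) (α₂.compContinuous (displace g₁) - α₁) x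
  rw [← hg] at hx
  simp only [BoundedContinuousFunction.sub_apply, BoundedContinuousFunction.compContinuous_apply,
    displace_apply] at hx
  rw [displace_apply, sub_eq_iff_eq_add.1 hx, hS₁, hS₂, displace_apply, T.map_add]
  abel

lemma leftInverse_displace (hA : IsGreenKernel T A) (hα : LipschitzWith K α₁)
    (hK : (∑' k, ‖A k‖) * K < 1) (hS₁ : ∀ x, S₁ x = T x + α₁ x) (hS₂ : ∀ x, S₂ x = T x + α₂ x)
    (hg₁ : g₁ = orbitSum A S₁ (α₂.compContinuous (displace g₁) - α₁))
    (hg₂ : g₂ = orbitSum A S₂ (α₁.compContinuous (displace g₂) - α₂)) :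
    Function.LeftInverse (displace g₂) (displace g₁) := by
  set d := g₁ + g₂.compContinuous (displace g₁) with hd
  have hcomp : ∀ x, displace g₂ (displace g₁ x) = x + d x := fun x => by
    simp only [hd, displace_apply, BoundedContinuousFunction.add_apply,
      BoundedContinuousFunction.compContinuous_apply]
    abel
  have hdA : d = orbitSum A S₁ (α₁.compContinuous (displace d)) - orbitSum A S₁ α₁ := by
    have hsemi := hA.semiconj_displace hS₁ hS₂ hg₁
    have hg₂' : g₂.compContinuous (displace g₁) = orbitSum A S₁
        (α₁.compContinuous (displace d) - α₂.compContinuous (displace g₁)) := by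
      conv_lhs => rw [hg₂, ← orbitSum_compContinuous hA.summable_norm _ hsemi]
      congr 1
      ext x
      simp only [BoundedContinuousFunction.sub_apply,
        BoundedContinuousFunction.compContinuous_apply, hcomp, displace_apply d]
    refine (congrArg₂ (· + ·) hg₁ hg₂').trans ?_
    rw [← orbitSum_add hA.summable_norm, ← orbitSum_sub hA.summable_norm]
    congr 1
    abel
  have hd_le : ‖d‖ ≤ (∑' k, ‖A k‖) * K * ‖d‖ := by
    conv_lhs => rw [hdA]
    refine hA.norm_orbitSum_sub_le hα _ (ContinuousMap.id E) fun x => ?_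
    simpa [displace_apply] using d.norm_coe_le_norm x
  have hd0 : d = 0 := norm_le_zero_iff.1 (by nlinarith [norm_nonneg d])
  intro x
  simp [hcomp, hd0]

theorem exists_conjugacy (hA : IsGreenKernel T A) (hα₁ : LipschitzWith K α₁)
    (hα₂ : LipschitzWith K α₂) (hK : (∑' k, ‖A k‖) * K < 1) (hS₁ : ∀ x, S₁ x = T x + α₁ x)
    (hS₂ : ∀ x, S₂ x = T x + α₂ x) :
    ∃ h : E ≃ₜ E, Function.Semiconj h S₁ S₂ ∧
      ∀ x, ‖h x - x‖ ≤ (∑' k, ‖A k‖) * (‖α₁‖ + ‖α₂‖) := by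
  obtain ⟨g₁, hg₁⟩ := hA.exists_eq_orbitSum_displace hα₂ hK S₁ α₁
  obtain ⟨g₂, hg₂⟩ := hA.exists_eq_orbitSum_displace hα₁ hK S₂ α₂
  refine ⟨⟨⟨displace g₁, displace g₂, hA.leftInverse_displace hα₁ hK hS₁ hS₂ hg₁ hg₂,
    hA.leftInverse_displace hα₂ hK hS₂ hS₁ hg₂ hg₁⟩, map_continuous _, map_continuous _⟩,
    hA.semiconj_displace hS₁ hS₂ hg₁, fun x => ?_⟩
  change ‖displace g₁ x - x‖ ≤ _
  rw [displace_apply, add_sub_cancel_left]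
  refine (g₁.norm_coe_le_norm x).trans ?_
  conv_lhs => rw [hg₁]
  refine (norm_orbitSum_le hA.summable_norm _).trans ?_
  gcongr
  rw [add_comm]
  exact (norm_sub_le _ _).trans (by gcongr; exact α₂.norm_compContinuous_le _)

end IsGreenKernel

lemma exists_homeomorph_of_lipschitz_perturbation [CompleteSpace E] (T : E ≃L[ℝ] E) :
    ∃ δ₀ : ℝ≥0, 0 < δ₀ ∧ ∀ α : E → E, LipschitzWith δ₀ α →
      ∃ S : E ≃ₜ E, ∀ x, S x = T x + α x := by
  set N := ‖(T.symm : E →L[ℝ] E)‖₊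
  refine ⟨(N + 1)⁻¹, by positivity, fun α hα => ?_⟩
  have happ : ApproximatesLinearOn (fun x => T x + α x) (T : E →L[ℝ] E) Set.univ (N + 1)⁻¹ := by
    intro x _ y _
    simpa [map_sub, add_sub_add_comm] using hα.norm_sub_le x y
  have hN : Subsingleton E ∨ (N + 1)⁻¹ < N⁻¹ := by
    rcases subsingleton_or_nontrivial E with hE | hE
    · exact Or.inl hE
    · exact Or.inr (inv_strictAnti₀ T.nnnorm_symm_pos (lt_add_one N))
  exact ⟨happ.toHomeomorph _ hN, fun _ => rfl⟩

theorem IsGreenKernel.isStronglyStructurallyStable [CompleteSpace E] {T : E ≃L[ℝ] E}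
    {A : ℤ → E →L[ℝ] E} (hA : IsGreenKernel (T : E →L[ℝ] E) A) :
    IsStronglyStructurallyStable (T : E →L[ℝ] E) := by
  refine ⟨ContinuousLinearMap.isUnit_iff_bijective.2 T.bijective, fun ε hε => ?_⟩
  obtain ⟨δ₀, hδ₀, hperturb⟩ := exists_homeomorph_of_lipschitz_perturbation T
  lift ε to ℝ≥0 using hε.le
  obtain ⟨ρ, hρ⟩ : ∃ ρ : ℝ≥0, ρ = ∑' k, ‖A k‖ := CanLift.prf _ (tsum_nonneg fun _ => norm_nonneg _)
  set δ := min δ₀ (min ε (1 / 2) / (ρ + 1))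
  have hρδ : ρ * δ ≤ min ε (1 / 2) :=
    calc ρ * δ ≤ (ρ + 1) * (min ε (1 / 2) / (ρ + 1)) :=
          mul_le_mul' le_self_add (min_le_right _ _)
      _ = min ε (1 / 2) := mul_div_cancel₀ _ (by positivity)
  have hε' : 0 < ε := hε
  refine ⟨δ, by positivity, fun α hα hαδ => ?_⟩
  obtain ⟨S, hS⟩ := hperturb α (hα.weaken (min_le_left _ _))
  set α' := BoundedContinuousFunction.ofNormedAddCommGroup α hα.continuous δ hαδ
  have hα'δ : ‖α'‖ ≤ δ := (BoundedContinuousFunction.norm_le δ.2).2 hαδ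
  have hK : (∑' k, ‖A k‖) * δ < 1 := by
    rw [← hρ]
    exact_mod_cast (hρδ.trans (min_le_right _ _)).trans_lt (half_lt_self one_pos)
  obtain ⟨h, hconj, hh⟩ := hA.exists_conjugacy (α₁ := 0) (S₁ := T.toHomeomorph) (α₂ := α')
    ((LipschitzWith.const 0).weaken zero_le) hα hK (by simp) hS
  refine ⟨h, fun x => (hconj x).trans (hS _), fun x => (hh x).trans ?_⟩
  rw [norm_zero, zero_add, ← hρ]
  exact (mul_le_mul_of_nonneg_left hα'δ ρ.2).trans
    (by exact_mod_cast hρδ.trans (min_le_left _ _))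

end StructuralStability

section GeneralizedHyperbolic

lemma summable_of_add_le_mul {a : ℕ → ℝ} (ha : ∀ k, 0 ≤ a k) {n : ℕ} {c : ℝ} (hc : c < 1)
    (h : ∀ k, a (n + k) ≤ c * a k) : Summable a := by
  refine summable_of_sum_range_le (c := (∑ k ∈ Finset.range n, a k) / (1 - c)) ha fun m => ?_
  have hextend : ∑ k ∈ Finset.range m, a k ≤ ∑ k ∈ Finset.range (n + m), a k :=
    Finset.sum_le_sum_of_subset_of_nonneg (Finset.range_mono (by lia)) fun k _ _ => ha k
  have htail : ∑ k ∈ Finset.range m, a (n + k) ≤ c * ∑ k ∈ Finset.range m, a k := by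
    rw [Finset.mul_sum]
    exact Finset.sum_le_sum fun k _ => h k
  rw [Finset.sum_range_add] at hextend
  rw [le_div_iff₀ (sub_pos.2 hc)]
  linarith

variable {E : Type*} [NormedAddCommGroup E] [NormedSpace ℝ E]

lemma summable_norm_pow_mul {U P : E →L[ℝ] E} (hP : ∀ x, P (P x) = P x)
    (hU : ∀ x, P x = x → P (U x) = U x) {n : ℕ} {c : ℝ≥0} (hc : c < 1)
    (hn : ∀ x, P x = x → ‖(U ^ n) x‖ ≤ c * ‖x‖) : Summable fun k : ℕ => ‖U ^ k * P‖ := by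
  have hfixed : ∀ (k : ℕ) x, P ((U ^ k) (P x)) = (U ^ k) (P x) := fun k x => by
    induction k with
    | zero => simpa using hP x
    | succ k ih =>
      rw [pow_succ']
      exact hU _ ih
  refine summable_of_add_le_mul (fun _ => norm_nonneg _) (n := n) (NNReal.coe_lt_one.2 hc)
    fun k => ContinuousLinearMap.opNorm_le_bound _ (by positivity) fun x => ?_
  rw [pow_add, mul_assoc, mul_assoc]
  refine (hn _ (hfixed k x)).trans ?_
  gcongr
  exact (U ^ k * P).le_opNorm x

/-- The operator `T` is generalized hyperbolic with respect to the projection `P`: the range of `P`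
is invariant under `T`, its kernel is invariant under `T⁻¹`, and some power of `T` on the range and
of `T⁻¹` on the kernel is a strict contraction. -/
structure IsGeneralizedHyperbolic (T : E ≃L[ℝ] E) (P : E →L[ℝ] E) : Prop where
  idempotent : ∀ x, P (P x) = P x
  map_fixed : ∀ x, P x = x → P (T x) = T x
  symm_map_ker : ∀ x, P x = 0 → P (T.symm x) = 0
  contracting : ∃ n : ℕ, ∃ c : ℝ≥0, c < 1 ∧
    ∀ x, P x = x → ‖((T : E →L[ℝ] E) ^ n) x‖ ≤ c * ‖x‖
  symm_contracting : ∃ n : ℕ, ∃ c : ℝ≥0, c < 1 ∧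
    ∀ x, P x = 0 → ‖((T.symm : E →L[ℝ] E) ^ n) x‖ ≤ c * ‖x‖

/-- The kernel with `A (-k - 1) = T ^ k ∘ P` and `A k = -T ^ (-k - 1) ∘ (1 - P)` for `k ≥ 0`: the
Green kernel of an operator that is generalized hyperbolic with respect to `P`. -/
def splittingKernel (T : E ≃L[ℝ] E) (P : E →L[ℝ] E) : ℤ → E →L[ℝ] E
  | Int.ofNat k => -((T.symm : E →L[ℝ] E) ^ (k + 1) * (1 - P))
  | Int.negSucc k => (T : E →L[ℝ] E) ^ k * P

lemma splittingKernel_recurrence (T : E ≃L[ℝ] E) (P : E →L[ℝ] E) (k : ℤ) :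
    splittingKernel T P (k - 1) - (T : E →L[ℝ] E) ∘L splittingKernel T P k =
      if k = 0 then 1 else 0 := by
  have hTV : (T : E →L[ℝ] E) * T.symm = 1 := ContinuousLinearMap.ext T.apply_symm_apply
  change _ - (T : E →L[ℝ] E) * _ = _
  rcases k with (_ | k) | k
  · change (T : E →L[ℝ] E) ^ 0 * P - T * -((T.symm : E →L[ℝ] E) ^ (0 + 1) * (1 - P)) = _
    simp [← mul_assoc, hTV]
  · have hk : (Int.ofNat (k + 1) - 1 : ℤ) = Int.ofNat k := by simp
    rw [if_neg (by simp; lia), hk]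
    simp [splittingKernel, pow_succ' _ (k + 1), ← mul_assoc, hTV]
  · have hk : (Int.negSucc k - 1 : ℤ) = Int.negSucc (k + 1) := by lia
    rw [if_neg (by simp), hk]
    simp [splittingKernel, pow_succ', mul_assoc]

namespace IsGeneralizedHyperbolic

variable {T : E ≃L[ℝ] E} {P : E →L[ℝ] E}

lemma summable_norm_splittingKernel (h : IsGeneralizedHyperbolic T P) :
    Summable fun k => ‖splittingKernel T P k‖ := by
  obtain ⟨n, c, hc, hn⟩ := h.contracting
  obtain ⟨m, d, hd, hm⟩ := h.symm_contracting
  have hker : ∀ x, (1 - P) x = x → P x = 0 := fun x hx => by simpa using hx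
  have hrange : Summable fun k : ℕ => ‖(T : E →L[ℝ] E) ^ k * P‖ :=
    summable_norm_pow_mul h.idempotent h.map_fixed hc hn
  have hkernel : Summable fun k : ℕ => ‖(T.symm : E →L[ℝ] E) ^ k * (1 - P)‖ := by
    refine summable_norm_pow_mul (fun x => ?_) (fun x hx => ?_) hd fun x hx => hm x (hker x hx)
    · simp [h.idempotent]
    · simpa using h.symm_map_ker x (hker x hx)
  refine Summable.of_nat_of_neg_add_one ?_ ?_
  · exact ((summable_nat_add_iff 1).2 hkernel).congr fun k => (norm_neg _).symm
  · exact hrange.congr fun k => by rw [← Int.negSucc_eq]; rfl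

lemma isGreenKernel (h : IsGeneralizedHyperbolic T P) :
    IsGreenKernel (T : E →L[ℝ] E) (splittingKernel T P) :=
  ⟨h.summable_norm_splittingKernel, splittingKernel_recurrence T P⟩

theorem isStronglyStructurallyStable [CompleteSpace E] (h : IsGeneralizedHyperbolic T P) :
    IsStronglyStructurallyStable (T : E →L[ℝ] E) :=
  h.isGreenKernel.isStronglyStructurallyStable

end IsGeneralizedHyperbolic

end GeneralizedHyperbolic

section OrliczSpace

variable {X : Type*} [MeasurableSpace X] {Φ : YoungFunction} {μ : Measure X}

lemma YoungFunction.le_of_abs_le (Φ : YoungFunction) {x y : ℝ} (h : |x| ≤ |y|) : Φ x ≤ Φ y := by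
  rw [← Φ.map_abs x, ← Φ.map_abs y]
  exact Φ.mono (abs_nonneg x) h

lemma orliczModular_mono_ae {f g : X → ℝ} (h : ∀ᵐ x ∂μ, |f x| ≤ |g x|) :
    orliczModular Φ μ f ≤ orliczModular Φ μ g :=
  lintegral_mono_ae (h.mono fun _ hx => Φ.le_of_abs_le hx)

-- `Φ` need not be continuous (it may jump to `∞`); shrinking the limit by `t < 1` makes
-- monotonicity enough.
lemma orliczModular_mul_le_of_tendsto {F : ℕ → X → ℝ} {f : X → ℝ} {C : ℝ≥0∞} {t : ℝ} (ht0 : 0 ≤ t)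
    (ht1 : t < 1) (hF : ∀ n, AEMeasurable (F n) μ)
    (hlim : ∀ᵐ x ∂μ, Tendsto (fun n => F n x) atTop (𝓝 (f x)))
    (hC : ∀ᶠ n in atTop, orliczModular Φ μ (F n) ≤ C) :
    orliczModular Φ μ (fun x => t * f x) ≤ C := by
  have hpoint : ∀ᵐ x ∂μ, Φ (t * f x) ≤ liminf (fun n => Φ (F n x)) atTop := by
    filter_upwards [hlim] with x hx
    rcases eq_or_ne (f x) 0 with h0 | h0
    · simp [h0, Φ.map_zero]
    have hlt : |t * f x| < |f x| := by
      rw [abs_mul, abs_of_nonneg ht0]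
      exact mul_lt_of_lt_one_left (abs_pos.2 h0) ht1
    exact le_liminf_of_le (by isBoundedDefault)
      ((hx.abs.eventually_const_lt hlt).mono fun n hn => Φ.le_of_abs_le hn.le)
  calc orliczModular Φ μ (fun x => t * f x)
      ≤ ∫⁻ x, liminf (fun n => Φ (F n x)) atTop ∂μ := lintegral_mono_ae hpoint
    _ ≤ liminf (fun n => ∫⁻ x, Φ (F n x) ∂μ) atTop :=
        lintegral_liminf_le' fun n => Φ.measurable.comp_aemeasurable (hF n)
    _ ≤ C := liminf_le_of_frequently_le' hC.frequently

lemma ae_summable_of_orliczModular_sum_le {F : ℕ → X → ℝ} (hF : ∀ n, Measurable (F n))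
    {C : ℝ≥0∞} (hC : C ≠ ∞)
    (h : ∀ n, orliczModular Φ μ (fun x => ∑ i ∈ Finset.range n, |F i x|) ≤ C) :
    ∀ᵐ x ∂μ, Summable fun n => F n x := by
  set G : ℕ → X → ℝ := fun n x => ∑ i ∈ Finset.range n, |F i x|
  have hG0 : ∀ n x, 0 ≤ G n x := fun n x => Finset.sum_nonneg fun _ _ => abs_nonneg _
  have hGmono : ∀ x, Monotone fun n => G n x := fun x =>
    (Finset.sum_mono_set_of_nonneg fun _ => abs_nonneg _).comp Finset.range_mono
  have hGm : ∀ n, Measurable fun x => Φ (G n x) := fun n =>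
    Φ.measurable.comp (Finset.measurable_sum _ fun i _ => (hF i).abs)
  have hsup : ∫⁻ x, ⨆ n, Φ (G n x) ∂μ ≤ C := by
    rw [lintegral_iSup hGm fun n m hnm x => Φ.mono (hG0 n x) (hGmono x hnm)]
    exact iSup_le h
  filter_upwards [ae_lt_top (Measurable.iSup hGm) (hsup.trans_lt hC.lt_top).ne] with x hx
  obtain ⟨r, hr, hr0⟩ := ((Φ.tendsto_top.eventually (lt_mem_nhds hx)).and
    (eventually_ge_atTop 0)).exists
  refine (summable_of_sum_range_le (c := r) (fun _ => abs_nonneg _) fun n => ?_).of_abs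
  by_contra! hlt
  exact absurd (hr.trans_le (Φ.mono hr0 hlt.le)) (not_lt.2 (le_iSup (fun n => Φ (G n x)) n))

namespace OrliczSpace

lemma coeFn_sub (f g : OrliczSpace Φ μ) :
    ((f - g : OrliczSpace Φ μ) : X →ₘ[μ] ℝ) =ᵐ[μ] fun x => (f : X →ₘ[μ] ℝ) x - (g : X →ₘ[μ] ℝ) x :=
  AEEqFun.coeFn_sub (f : X →ₘ[μ] ℝ) (g : X →ₘ[μ] ℝ)

lemma coeFn_zero : ((0 : OrliczSpace Φ μ) : X →ₘ[μ] ℝ) =ᵐ[μ] fun _ => 0 :=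
  AEEqFun.coeFn_zero

lemma coeFn_sum (u : ℕ → OrliczSpace Φ μ) (n : ℕ) :
    ((∑ i ∈ Finset.range n, u i : OrliczSpace Φ μ) : X →ₘ[μ] ℝ) =ᵐ[μ]
      fun x => ∑ i ∈ Finset.range n, (u i : X →ₘ[μ] ℝ) x := by
  induction n with
  | zero => simpa using coeFn_zero (Φ := Φ)
  | succ n ih =>
    simp only [Finset.sum_range_succ]
    filter_upwards [ih, AEEqFun.coeFn_add (∑ i ∈ Finset.range n, u i : OrliczSpace Φ μ).1 (u n).1]
      with x hsum hadd
    simpa [← hsum] using hadd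

lemma ext_ae {f g : OrliczSpace Φ μ} (h : (f : X →ₘ[μ] ℝ) =ᵐ[μ] (g : X →ₘ[μ] ℝ)) : f = g :=
  Subtype.ext (AEEqFun.ext h)

lemma eq_zero_of_ae {f : OrliczSpace Φ μ} (h : ∀ᵐ x ∂μ, (f : X →ₘ[μ] ℝ) x = 0) : f = 0 :=
  ext_ae (EventuallyEq.trans h coeFn_zero.symm)

lemma modular_le_one {f : OrliczSpace Φ μ} {a : ℝ} (h : ‖f‖ < a) :
    orliczModular Φ μ (fun x => (f : X →ₘ[μ] ℝ) x / a) ≤ 1 :=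
  modular_le_one_of_gaugeNorm_lt Φ μ f.2 h

lemma norm_le_of_forall_modular_le_one {f : OrliczSpace Φ μ} {a : ℝ} (ha : 0 ≤ a)
    (h : ∀ b, a < b → orliczModular Φ μ (fun x => (f : X →ₘ[μ] ℝ) x / b) ≤ 1) : ‖f‖ ≤ a :=
  le_of_forall_gt_imp_ge_of_dense fun b hb => gaugeNorm_le Φ μ (ha.trans_lt hb) (h b hb)

lemma norm_le_mul_of_modular {f g : OrliczSpace Φ μ} {t : ℝ} (ht : 0 < t)
    (h : ∀ a : ℝ, 0 < a → orliczModular Φ μ (fun x => (f : X →ₘ[μ] ℝ) x / a) ≤ 1 →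
      orliczModular Φ μ (fun x => (g : X →ₘ[μ] ℝ) x / (t * a)) ≤ 1) : ‖g‖ ≤ t * ‖f‖ := by
  refine norm_le_of_forall_modular_le_one (by positivity) fun b hb => ?_
  have hfb : ‖f‖ < b / t := (lt_div_iff₀' ht).2 hb
  simpa [mul_div_cancel₀ _ ht.ne'] using
    h _ ((norm_nonneg f).trans_lt hfb) (modular_le_one hfb)

lemma mem_of_ae_abs_le {f : X →ₘ[μ] ℝ} {g : OrliczSpace Φ μ}
    (h : ∀ᵐ x ∂μ, |f x| ≤ |(g : X →ₘ[μ] ℝ) x|) : f ∈ OrliczSpace Φ μ := by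
  obtain ⟨k, hk, hg⟩ := g.2
  refine ⟨k, hk, (orliczModular_mono_ae (h.mono fun x hx => ?_)).trans_lt hg⟩
  rw [abs_mul, abs_mul]
  gcongr

lemma norm_le_of_ae_abs_le {f g : OrliczSpace Φ μ}
    (h : ∀ᵐ x ∂μ, |(f : X →ₘ[μ] ℝ) x| ≤ |(g : X →ₘ[μ] ℝ) x|) : ‖f‖ ≤ ‖g‖ := by
  refine norm_le_of_forall_modular_le_one (norm_nonneg g) fun b hb =>
    (orliczModular_mono_ae (h.mono fun x hx => ?_)).trans (modular_le_one hb)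
  rw [abs_div, abs_div]
  gcongr

lemma ae_summable {u : ℕ → OrliczSpace Φ μ} (hu : Summable fun n => ‖u n‖) :
    ∀ᵐ x ∂μ, Summable fun n => (u n : X →ₘ[μ] ℝ) x := by
  have habs : ∀ n, ⇑(|↑(u n)| : X →ₘ[μ] ℝ) =ᵐ[μ] fun x => |(u n : X →ₘ[μ] ℝ) x| :=
    fun n => AEEqFun.coeFn_abs _
  let v : ℕ → OrliczSpace Φ μ := fun n => ⟨|(u n : X →ₘ[μ] ℝ)|,
    mem_of_ae_abs_le (g := u n) ((habs n).mono fun x hx => by rw [hx, abs_abs])⟩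
  have hv : ∀ n, ‖v n‖ ≤ ‖u n‖ := fun n =>
    norm_le_of_ae_abs_le ((habs n).mono fun x hx => by rw [hx, abs_abs])
  set a : ℝ := ∑' n, ‖u n‖ + 1
  have hlt : ∀ n, ‖∑ i ∈ Finset.range n, v i‖ < a := fun n =>
    calc ‖∑ i ∈ Finset.range n, v i‖
        ≤ ∑ i ∈ Finset.range n, ‖u i‖ := norm_sum_le_of_le _ fun i _ => hv i
      _ ≤ ∑' n, ‖u n‖ := hu.sum_le_tsum _ fun _ _ => norm_nonneg _
      _ < a := lt_add_one _
  have ha : 0 < a := (norm_nonneg _).trans_lt (hlt 0)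
  have hsum := ae_summable_of_orliczModular_sum_le (Φ := Φ) (μ := μ)
    (F := fun n x => (u n : X →ₘ[μ] ℝ) x / a)
    (fun n => (u n : X →ₘ[μ] ℝ).stronglyMeasurable.measurable.div_const a) ENNReal.one_ne_top
    fun n => by
      refine (orliczModular_congr Φ μ ?_).trans_le (modular_le_one (hlt n))
      filter_upwards [coeFn_sum v n, ae_all_iff.2 habs] with x hx hvx
      rw [hx, Finset.sum_div]
      exact Finset.sum_congr rfl fun i _ => by rw [abs_div, abs_of_pos ha, ← hvx i]
  filter_upwards [hsum] with x hx
  simpa [div_mul_cancel₀ _ ha.ne'] using hx.mul_right a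

lemma modular_le_one_of_tendsto_ae {u : ℕ → OrliczSpace Φ μ} {g : X →ₘ[μ] ℝ} {a b : ℝ}
    (hlim : ∀ᵐ x ∂μ, Tendsto (fun n => (u n : X →ₘ[μ] ℝ) x) atTop (𝓝 (g x)))
    (ha : ∀ᶠ n in atTop, ‖u n‖ ≤ a) (hab : a < b) : orliczModular Φ μ (fun x => g x / b) ≤ 1 := by
  obtain ⟨n, hn⟩ := ha.exists
  obtain ⟨c, hac, hcb⟩ := exists_between hab
  have hc : 0 < c := ((norm_nonneg _).trans hn).trans_lt hac
  have hb : 0 < b := hc.trans hcb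
  have hmod := orliczModular_mul_le_of_tendsto (Φ := Φ) (t := c / b) (C := 1)
    (F := fun n x => (u n : X →ₘ[μ] ℝ) x / c) (by positivity) ((div_lt_one hb).2 hcb)
    (fun n => (AEEqFun.aemeasurable _).div_const c)
    (hlim.mono fun x hx => hx.div_const c)
    (ha.mono fun n hn => modular_le_one (hn.trans_lt hac))
  convert hmod using 2 with x
  field_simp

lemma exists_norm_le_of_tendsto_ae {u : ℕ → OrliczSpace Φ μ} {g : X →ₘ[μ] ℝ} {a : ℝ}
    (hlim : ∀ᵐ x ∂μ, Tendsto (fun n => (u n : X →ₘ[μ] ℝ) x) atTop (𝓝 (g x)))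
    (ha : ∀ᶠ n in atTop, ‖u n‖ ≤ a) : ∃ f : OrliczSpace Φ μ, f = g ∧ ‖f‖ ≤ a := by
  obtain ⟨n, hn⟩ := ha.exists
  have ha0 : 0 ≤ a := (norm_nonneg _).trans hn
  have hmod : ∀ b, a < b → orliczModular Φ μ (fun x => g x / b) ≤ 1 :=
    fun b hb => modular_le_one_of_tendsto_ae hlim ha hb
  have hg : g ∈ OrliczSpace Φ μ := ⟨(a + 1)⁻¹, by positivity, by
    simpa only [div_eq_inv_mul] using (hmod (a + 1) (lt_add_one a)).trans_lt ENNReal.one_lt_top⟩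
  exact ⟨⟨g, hg⟩, rfl, norm_le_of_forall_modular_le_one ha0 hmod⟩

instance instCompleteSpace : CompleteSpace (OrliczSpace Φ μ) := by
  refine NormedAddCommGroup.completeSpace_of_summable_imp_tendsto fun u hu => ?_
  set s : ℕ → OrliczSpace Φ μ := fun n => ∑ i ∈ Finset.range n, u i
  have hcauchy : CauchySeq s := cauchySeq_range_of_norm_bounded
    hu.hasSum.tendsto_sum_nat.cauchySeq fun _ => le_rfl
  obtain ⟨g, hlim⟩ : ∃ g : X →ₘ[μ] ℝ,
      ∀ᵐ x ∂μ, Tendsto (fun n => (s n : X →ₘ[μ] ℝ) x) atTop (𝓝 (g x)) := by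
    have hsum : ∀ᵐ x ∂μ, Tendsto (fun n => (s n : X →ₘ[μ] ℝ) x) atTop
        (𝓝 (∑' n, (u n : X →ₘ[μ] ℝ) x)) := by
      filter_upwards [ae_summable hu, ae_all_iff.2 (coeFn_sum u)] with x hx hsx
      simpa only [s, hsx] using hx.hasSum.tendsto_sum_nat
    have hm := aestronglyMeasurable_of_tendsto_ae atTop
      (fun n => AEEqFun.aestronglyMeasurable (s n : X →ₘ[μ] ℝ)) hsum
    exact ⟨AEEqFun.mk _ hm, by filter_upwards [hsum, AEEqFun.coeFn_mk _ hm] with x hx hg; rwa [hg]⟩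
  obtain ⟨R, hR⟩ := hcauchy.isBounded_range.exists_norm_le
  obtain ⟨f, rfl, -⟩ := exists_norm_le_of_tendsto_ae hlim (.of_forall fun n => hR _ ⟨n, rfl⟩)
  refine ⟨f, Metric.tendsto_atTop'.2 fun ε hε => ?_⟩
  obtain ⟨N, hN⟩ := Metric.cauchySeq_iff.1 hcauchy (ε / 2) (by positivity)
  refine ⟨N, fun n hn => ?_⟩
  obtain ⟨d, hd, hdε⟩ := exists_norm_le_of_tendsto_ae (u := fun m => s m - s n)
    (g := ((f - s n : OrliczSpace Φ μ) : X →ₘ[μ] ℝ)) (a := ε / 2)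
    (by
      filter_upwards [hlim, ae_all_iff.2 fun m => coeFn_sub (s m) (s n), coeFn_sub f (s n)]
        with x hx hm hf
      simpa only [hm, hf] using hx.sub_const _)
    ((eventually_ge_atTop N).mono fun m hm => by
      rw [← dist_eq_norm]
      exact (hN m hm n hn.le).le)
  rw [dist_comm, dist_eq_norm, ← Subtype.ext hd]
  exact hdε.trans_lt (half_lt_self hε)

end OrliczSpace

end OrliczSpace

section CompositionOperators

variable {X : Type*} [MeasurableSpace X] {Φ : YoungFunction} {μ : Measure X}

/-- Multiplication by `χ_S` on the space of a.e. classes of functions. -/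
noncomputable def aeRestrict (μ : Measure X) (S : Set X) (hS : MeasurableSet S) :
    (X →ₘ[μ] ℝ) →ₗ[ℝ] (X →ₘ[μ] ℝ) where
  toFun f := AEEqFun.mk (S.indicator f) (f.aestronglyMeasurable.indicator hS)
  map_add' f g := by
    refine AEEqFun.ext ((AEEqFun.coeFn_mk _ _).trans (.trans ?_ (AEEqFun.coeFn_add _ _).symm))
    filter_upwards [AEEqFun.coeFn_add f g,
      AEEqFun.coeFn_mk _ (f.aestronglyMeasurable.indicator hS),
      AEEqFun.coeFn_mk _ (g.aestronglyMeasurable.indicator hS)] with x hadd hf hg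
    by_cases hx : x ∈ S <;> simp [hx, hadd, hf, hg]
  map_smul' r f := by
    refine AEEqFun.ext ((AEEqFun.coeFn_mk _ _).trans (.trans ?_ (AEEqFun.coeFn_smul _ _).symm))
    filter_upwards [AEEqFun.coeFn_smul r f,
      AEEqFun.coeFn_mk _ (f.aestronglyMeasurable.indicator hS)] with x hsmul hf
    by_cases hx : x ∈ S <;> simp [hx, hsmul, hf]

lemma coeFn_aeRestrict {S : Set X} (hS : MeasurableSet S) (f : X →ₘ[μ] ℝ) :
    ⇑(aeRestrict μ S hS f) =ᵐ[μ] S.indicator f :=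
  AEEqFun.coeFn_mk _ _

lemma ae_abs_aeRestrict_le {S : Set X} (hS : MeasurableSet S) (f : X →ₘ[μ] ℝ) :
    ∀ᵐ x ∂μ, |aeRestrict μ S hS f x| ≤ |f x| := by
  filter_upwards [coeFn_aeRestrict hS f] with x hx
  simpa only [hx, Real.norm_eq_abs] using norm_indicator_le_norm_self (⇑f) x

namespace OrliczSpace

/-- The projection `f ↦ χ_S f` of `L^Φ(μ)` onto the functions supported in `S`. -/
noncomputable def restrictTo (Φ : YoungFunction) (μ : Measure X) (S : Set X)
    (hS : MeasurableSet S) : OrliczSpace Φ μ →L[ℝ] OrliczSpace Φ μ :=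
  LinearMap.mkContinuous
    ((aeRestrict μ S hS).restrict fun f hf =>
      mem_of_ae_abs_le (g := ⟨f, hf⟩) (ae_abs_aeRestrict_le hS f))
    1 fun f => by
      rw [one_mul]
      exact norm_le_of_ae_abs_le (ae_abs_aeRestrict_le hS (f : X →ₘ[μ] ℝ))

variable {S : Set X} {hS : MeasurableSet S}

lemma coeFn_restrictTo (f : OrliczSpace Φ μ) :
    (restrictTo Φ μ S hS f : X →ₘ[μ] ℝ) =ᵐ[μ] S.indicator (f : X →ₘ[μ] ℝ) :=
  coeFn_aeRestrict hS (f : X →ₘ[μ] ℝ)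

lemma restrictTo_eq_self_iff {f : OrliczSpace Φ μ} :
    restrictTo Φ μ S hS f = f ↔ ∀ᵐ x ∂μ, x ∉ S → (f : X →ₘ[μ] ℝ) x = 0 := by
  refine ⟨fun h => ?_, fun h => ext_ae ?_⟩
  · filter_upwards [coeFn_restrictTo (hS := hS) f] with x hx hxS
    rw [h] at hx
    rw [hx, Set.indicator_of_notMem hxS]
  · filter_upwards [coeFn_restrictTo (hS := hS) f, h] with x hx hf
    rw [hx]
    by_cases hxS : x ∈ S <;> simp [hxS, hf]

lemma restrictTo_eq_zero_iff {f : OrliczSpace Φ μ} :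
    restrictTo Φ μ S hS f = 0 ↔ ∀ᵐ x ∂μ, x ∈ S → (f : X →ₘ[μ] ℝ) x = 0 := by
  refine ⟨fun h => ?_, fun h => eq_zero_of_ae ?_⟩
  · filter_upwards [coeFn_restrictTo (hS := hS) f, coeFn_zero (Φ := Φ) (μ := μ)] with x hx h0 hxS
    rw [h, h0, Set.indicator_of_mem hxS] at hx
    exact hx.symm
  · filter_upwards [coeFn_restrictTo (hS := hS) f, h] with x hx hf
    rw [hx]
    by_cases hxS : x ∈ S <;> simp [hxS, hf]

lemma restrictTo_restrictTo (f : OrliczSpace Φ μ) :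
    restrictTo Φ μ S hS (restrictTo Φ μ S hS f) = restrictTo Φ μ S hS f := by
  rw [restrictTo_eq_self_iff]
  filter_upwards [coeFn_restrictTo (hS := hS) f] with x hx hxS
  rw [hx, Set.indicator_of_notMem hxS]

end OrliczSpace

namespace IsCompositionSystem

variable {φ : Equiv.Perm X}

lemma inv (h : IsCompositionSystem μ φ)
    (hinv : ∃ c : ℝ≥0, 0 < c ∧ ∀ A : Set X, MeasurableSet A → μ (φ '' A) ≤ c * μ A) :
    IsCompositionSystem μ φ⁻¹ where
  measurable := h.measurable_symm
  measurable_symm := h.measurable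
  bound := by
    simpa only [Equiv.Perm.inv_def, ← Equiv.image_eq_preimage_symm] using hinv

lemma coeFn_compositionOperator_pow (h : IsCompositionSystem μ φ) (n : ℕ) (f : OrliczSpace Φ μ) :
    (((h.compositionOperator Φ ^ n) f : OrliczSpace Φ μ) : X →ₘ[μ] ℝ) =ᵐ[μ]
      (f : X →ₘ[μ] ℝ) ∘ (φ ^ n : Equiv.Perm X) := by
  induction n with
  | zero => exact ae_eq_refl _
  | succ n ih =>
    rw [pow_succ', pow_succ, Equiv.Perm.coe_mul, ← Function.comp_assoc]
    exact (h.compositionOperator_ae Φ _).trans (h.quasi.ae_eq_comp ih)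

lemma compositionOperator_comp_inv (h : IsCompositionSystem μ φ) (h' : IsCompositionSystem μ φ⁻¹)
    (f : OrliczSpace Φ μ) : h.compositionOperator Φ (h'.compositionOperator Φ f) = f :=
  OrliczSpace.ext_ae <| by
    filter_upwards [h.compositionOperator_ae Φ (h'.compositionOperator Φ f),
      h.quasi.ae_eq_comp (h'.compositionOperator_ae Φ f)] with x hout hin
    rw [hout, hin]
    simp

/-- The composition operator of a system with non-singular inverse, as an automorphism of
`L^Φ(μ)`. -/
noncomputable def compositionEquiv (h : IsCompositionSystem μ φ) (h' : IsCompositionSystem μ φ⁻¹)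
    (Φ : YoungFunction) : OrliczSpace Φ μ ≃L[ℝ] OrliczSpace Φ μ :=
  ContinuousLinearEquiv.equivOfInverse (h.compositionOperator Φ) (h'.compositionOperator Φ)
    (compositionOperator_comp_inv h' h) (compositionOperator_comp_inv h h')

theorem isStronglyStructurallyStable_of_contracting (h : IsCompositionSystem μ φ)
    (h' : IsCompositionSystem μ φ⁻¹) {S : Set X} (hS : MeasurableSet S)
    (hφS : ∀ x, φ x ∈ S → x ∈ S)
    (hc : ∃ n : ℕ, ∃ c : ℝ≥0, c < 1 ∧ ∀ f : OrliczSpace Φ μ,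
      (∀ᵐ x ∂μ, x ∉ S → (f : X →ₘ[μ] ℝ) x = 0) → ‖(h.compositionOperator Φ ^ n) f‖ ≤ c * ‖f‖)
    (hc' : ∃ n : ℕ, ∃ c : ℝ≥0, c < 1 ∧ ∀ f : OrliczSpace Φ μ,
      (∀ᵐ x ∂μ, x ∈ S → (f : X →ₘ[μ] ℝ) x = 0) → ‖(h'.compositionOperator Φ ^ n) f‖ ≤ c * ‖f‖) :
    IsStronglyStructurallyStable (h.compositionOperator Φ) :=
  IsGeneralizedHyperbolic.isStronglyStructurallyStable
    (T := h.compositionEquiv h' Φ) (P := OrliczSpace.restrictTo Φ μ S hS)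
    { idempotent := OrliczSpace.restrictTo_restrictTo
      map_fixed := fun f hf => by
        rw [OrliczSpace.restrictTo_eq_self_iff] at hf ⊢
        filter_upwards [h.compositionOperator_ae Φ f, h.quasi.ae hf] with x hcomp hx hxS
        exact hcomp.trans (hx fun hφx => hxS (hφS x hφx))
      symm_map_ker := fun f hf => by
        rw [OrliczSpace.restrictTo_eq_zero_iff] at hf ⊢
        filter_upwards [h'.compositionOperator_ae Φ f, h'.quasi.ae hf] with x hcomp hx hxS
        exact hcomp.trans (hx (hφS _ (by simpa using hxS)))
      contracting := hc.imp fun _ => Exists.imp fun _ hn =>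
        ⟨hn.1, fun f hf => hn.2 f (OrliczSpace.restrictTo_eq_self_iff.1 hf)⟩
      symm_contracting := hc'.imp fun _ => Exists.imp fun _ hn =>
        ⟨hn.1, fun f hf => hn.2 f (OrliczSpace.restrictTo_eq_zero_iff.1 hf)⟩ }

end IsCompositionSystem

end CompositionOperators

section IndicatorGauge

variable {X : Type*} [MeasurableSpace X] {Φ : YoungFunction} {μ : Measure X} {A A' : Set X} {k : ℝ}

/-- The gauge norm `N_Φ(χ_A)`. -/
noncomputable def indicatorGauge (Φ : YoungFunction) (μ : Measure X) (A : Set X) : ℝ :=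
  gaugeNorm Φ μ (A.indicator fun _ => (1 : ℝ))

lemma orliczModular_const_mul_indicator (hA : MeasurableSet A) (k : ℝ) :
    orliczModular Φ μ (fun x => k * A.indicator (fun _ => (1 : ℝ)) x) = Φ k * μ A := by
  rw [← lintegral_indicator_const hA]
  refine lintegral_congr fun x => ?_
  by_cases hx : x ∈ A <;> simp [hx, Φ.map_zero]

lemma orliczModular_indicator_div (hA : MeasurableSet A) (k : ℝ) :
    orliczModular Φ μ (fun x => A.indicator (fun _ => (1 : ℝ)) x / k) = Φ k⁻¹ * μ A := by
  simpa only [div_eq_inv_mul] using orliczModular_const_mul_indicator hA k⁻¹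

lemma one_lt_of_lt_indicatorGauge (hA : MeasurableSet A) (hk : 0 < k)
    (h : k < indicatorGauge Φ μ A) : 1 < Φ k⁻¹ * μ A := by
  by_contra! hle
  rw [← orliczModular_indicator_div hA] at hle
  exact absurd h (not_lt.2 (gaugeNorm_le Φ μ hk hle))

lemma le_one_of_indicatorGauge_lt (hΦ : ∃ x, 0 < x ∧ Φ x ≠ ∞) (hA : MeasurableSet A)
    (hfin : μ A ≠ ∞) (h : indicatorGauge Φ μ A < k) : Φ k⁻¹ * μ A ≤ 1 := by
  rw [← orliczModular_indicator_div hA]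
  obtain ⟨x, hx, hΦx⟩ := hΦ
  refine modular_le_one_of_gaugeNorm_lt Φ μ ⟨x, hx, ?_⟩ h
  rw [orliczModular_const_mul_indicator hA]
  exact ENNReal.mul_lt_top hΦx.lt_top hfin.lt_top

lemma indicatorGauge_nonneg : 0 ≤ indicatorGauge Φ μ A :=
  gaugeNorm_nonneg Φ μ _

lemma indicatorGauge_pos (hΦ : ∃ x, 0 < x ∧ Φ x ≠ ∞) (hA : MeasurableSet A)
    (hfin : μ A ≠ ∞) (hpos : μ A ≠ 0) : 0 < indicatorGauge Φ μ A := by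
  obtain ⟨r, hr, hr0⟩ := ((Φ.tendsto_top.eventually
    (lt_mem_nhds (ENNReal.inv_lt_top.2 (pos_iff_ne_zero.2 hpos)))).and
      (eventually_gt_atTop 0)).exists
  by_contra! hle
  have hmod := le_one_of_indicatorGauge_lt hΦ hA hfin (hle.trans_lt (inv_pos.2 hr0))
  rw [inv_inv, ← ENNReal.le_inv_iff_mul_le] at hmod
  exact absurd hr (not_lt.2 hmod)

lemma measure_le_of_indicatorGauge_lt (hΦ : ∃ x, 0 < x ∧ Φ x ≠ ∞) (hA : MeasurableSet A)
    (hA' : MeasurableSet A') (hfin' : μ A' ≠ ∞) {t : ℝ≥0} (ht1 : t ≤ 1)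
    (h : indicatorGauge Φ μ A' < t * indicatorGauge Φ μ A) : μ A' ≤ t * μ A := by
  have ht : (0 : ℝ) < t :=
    pos_of_mul_pos_left (indicatorGauge_nonneg.trans_lt h) indicatorGauge_nonneg
  obtain ⟨k, hk', hk⟩ := exists_between ((div_lt_iff₀' ht).2 h)
  have hk0 : 0 < k := (div_nonneg indicatorGauge_nonneg ht.le).trans_lt hk'
  have hlower := one_lt_of_lt_indicatorGauge hA hk0 hk
  have hupper := le_one_of_indicatorGauge_lt hΦ hA' hfin' ((div_lt_iff₀' ht).1 hk')
  have hconvex : Φ k⁻¹ ≤ t * Φ (t * k)⁻¹ := by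
    simpa only [mul_inv, mul_inv_cancel_left₀ ht.ne'] using Φ.smul_le t ht1 (t * k)⁻¹
  calc μ A' ≤ μ A' * (Φ k⁻¹ * μ A) := le_mul_of_one_le_right' hlower.le
    _ ≤ μ A' * (t * Φ (t * k)⁻¹ * μ A) := by gcongr
    _ = t * μ A * (Φ (t * k)⁻¹ * μ A') := by ring
    _ ≤ t * μ A := mul_le_of_le_one_right' hupper

lemma YoungFunction.inverse_one_div_measure (hΦ : ∃ x, 0 < x ∧ Φ x ≠ ∞) (hA : MeasurableSet A)
    (hfin : μ A ≠ ∞) (hpos : μ A ≠ 0) :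
    Φ.inverse (1 / μ A) = ENNReal.ofReal (indicatorGauge Φ μ A)⁻¹ := by
  have hN := indicatorGauge_pos hΦ hA hfin hpos
  have hlt_iff : ∀ x : ℝ, 1 / μ A < Φ x ↔ 1 < Φ x * μ A := fun x =>
    ENNReal.div_lt_iff (.inl hpos) (.inl hfin)
  refine le_antisymm (le_of_forall_gt_imp_ge_of_dense fun q hq => ?_) (le_iInf₂ fun x hx => ?_)
  · obtain ⟨x, hNx, hxq⟩ := ENNReal.lt_iff_exists_nnreal_btwn.1 hq
    have hNx' : (indicatorGauge Φ μ A)⁻¹ < x :=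
      (ENNReal.ofReal_lt_coe_iff (inv_pos.2 hN).le).1 hNx
    have hx0 : (0 : ℝ) < x := (inv_pos.2 hN).trans hNx'
    refine (iInf₂_le x ((hlt_iff x).2 ?_)).trans hxq.le
    simpa using one_lt_of_lt_indicatorGauge hA (inv_pos.2 hx0) (inv_lt_of_inv_lt₀ hN hNx')
  · rw [hlt_iff] at hx
    have hx0 : 0 < x := pos_iff_ne_zero.2 fun h0 => by simp [h0, Φ.map_zero] at hx
    rw [ENNReal.ofReal_le_coe]
    by_contra! hlt
    have hle := le_one_of_indicatorGauge_lt hΦ hA hfin (lt_inv_of_lt_inv₀ hx0 hlt)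
    rw [inv_inv] at hle
    exact absurd hx (not_lt.2 hle)

end IndicatorGauge

section Rates

variable {ι : Type*}

lemma eventually_forall_le_of_limsup_rpow_lt_one {a : ℕ → ι → ℝ≥0∞}
    (h : limsup (fun n : ℕ => ⨆ i, a n i ^ (1 / (n : ℝ))) atTop < 1) {t : ℝ≥0∞} (ht : 0 < t) :
    ∀ᶠ n in atTop, ∀ i, a n i ≤ t := by
  obtain ⟨r, hr, hr1⟩ := exists_between h
  filter_upwards [eventually_lt_of_limsup_lt hr, eventually_gt_atTop 0,
    (ENNReal.tendsto_pow_atTop_nhds_zero_of_lt_one hr1).eventually (gt_mem_nhds ht)]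
    with n hsup hn0 hpow i
  have hn : (0 : ℝ) < n := by exact_mod_cast hn0
  calc a n i = (a n i ^ (1 / (n : ℝ))) ^ (n : ℝ) := by
        rw [← ENNReal.rpow_mul, one_div_mul_cancel hn.ne', ENNReal.rpow_one]
    _ ≤ r ^ (n : ℝ) := by
        gcongr
        exact (le_iSup (fun i => a n i ^ (1 / (n : ℝ))) i).trans hsup.le
    _ = r ^ n := ENNReal.rpow_natCast _ _
    _ ≤ t := hpow.le

lemma eventually_forall_le_of_one_lt_liminf_rpow {a : ℕ → ι → ℝ≥0∞}
    (h : 1 < liminf (fun n : ℕ => ⨅ i, a n i ^ (1 / (n : ℝ))) atTop) {t : ℝ≥0∞} (ht : t ≠ ∞) :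
    ∀ᶠ n in atTop, ∀ i, t ≤ a n i := by
  obtain ⟨r, hr1, hr⟩ := exists_between h
  filter_upwards [eventually_lt_of_lt_liminf hr, eventually_gt_atTop 0,
    (ENNReal.tendsto_pow_atTop_nhds_zero_of_lt_one (ENNReal.inv_lt_one.2 hr1)).eventually
      (gt_mem_nhds (ENNReal.inv_pos.2 ht))] with n hinf hn0 hpow i
  have hn : (0 : ℝ) < n := by exact_mod_cast hn0
  rw [← ENNReal.inv_pow, ENNReal.inv_lt_inv] at hpow
  calc t ≤ r ^ n := hpow.le
    _ = r ^ (n : ℝ) := (ENNReal.rpow_natCast _ _).symm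
    _ ≤ (a n i ^ (1 / (n : ℝ))) ^ (n : ℝ) := by
        gcongr
        exact hinf.le.trans (iInf_le (fun i => a n i ^ (1 / (n : ℝ))) i)
    _ = a n i := by rw [← ENNReal.rpow_mul, one_div_mul_cancel hn.ne', ENNReal.rpow_one]

variable {w : ℤ → ℝ} {u : ℤ → ℝ≥0∞} {i j : ℕ → ι → ℤ} {t : ℝ}

lemma eventually_le_mul_of_limsup_lt_one (hw : ∀ k, 0 < w k)
    (hu : ∀ k, u k = ENNReal.ofReal (w k)⁻¹)
    (h : limsup (fun n : ℕ => ⨆ k, (u (i n k) / u (j n k)) ^ (1 / (n : ℝ))) atTop < 1)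
    (ht : 0 < t) : ∀ᶠ n in atTop, ∀ k, w (j n k) ≤ t * w (i n k) := by
  filter_upwards [eventually_forall_le_of_limsup_rpow_lt_one h (ENNReal.ofReal_pos.2 ht)]
    with n hn k
  specialize hn k
  rwa [hu, hu, ← ENNReal.ofReal_div_of_pos (inv_pos.2 (hw _)), ENNReal.ofReal_le_ofReal_iff ht.le,
    div_inv_eq_mul, inv_mul_le_iff₀ (hw _), mul_comm] at hn

lemma eventually_le_mul_of_one_lt_liminf (hw : ∀ k, 0 < w k)
    (hu : ∀ k, u k = ENNReal.ofReal (w k)⁻¹)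
    (h : 1 < liminf (fun n : ℕ => ⨅ k, (u (i n k) / u (j n k)) ^ (1 / (n : ℝ))) atTop)
    (ht : 0 < t) : ∀ᶠ n in atTop, ∀ k, w (i n k) ≤ t * w (j n k) := by
  filter_upwards [eventually_forall_le_of_one_lt_liminf_rpow h
    (ENNReal.ofReal_ne_top (r := t⁻¹))] with n hn k
  have hwi := hw (i n k)
  have hwj := hw (j n k)
  specialize hn k
  rwa [hu, hu, ← ENNReal.ofReal_div_of_pos (inv_pos.2 hwj),
    ENNReal.ofReal_le_ofReal_iff (by positivity), div_inv_eq_mul, inv_mul_eq_div,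
    le_div_iff₀ hwi, inv_mul_le_iff₀ ht] at hn

lemma exists_forall_le_mul_of_eventually_le {f g : ℕ → ℝ} (hg : ∀ n, 0 < g n)
    (h : ∀ᶠ n in atTop, f n ≤ g n) : ∃ B, 0 < B ∧ ∀ n, f n ≤ B * g n := by
  obtain ⟨B, hB⟩ := (isBoundedUnder_of_eventually_le (f := atTop) (u := fun n => f n / g n) (a := 1)
    (h.mono fun n hn => (div_le_one (hg n)).2 hn)).bddAbove_range
  refine ⟨max B 1, lt_max_of_lt_right one_pos, fun n => (div_le_iff₀ (hg n)).1 ?_⟩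
  exact (hB ⟨n, rfl⟩).trans (le_max_left _ _)

/-- The sequence `w` decays towards `-∞`, uniformly from all starting points in `J`. The decay is
exponential as soon as `J` is a lower set, since the steps can be iterated. -/
def DecaysLeftOn (w : ℤ → ℝ) (J : Set ℤ) : Prop :=
  ∀ t : ℝ, 0 < t → ∀ᶠ n : ℕ in atTop, ∀ k ∈ J, w (k - n) ≤ t * w k

-- A stretch crossing `0` has a long half, which decays, and its other half costs a bounded factor.
lemma decaysLeftOn_univ_of_half_lines (hw : ∀ k, 0 < w k) (hneg : DecaysLeftOn w (Set.Iic 0))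
    (hpos : ∀ t : ℝ, 0 < t → ∀ᶠ n : ℕ in atTop, ∀ k : ℤ, 0 ≤ k → w k ≤ t * w (k + n)) :
    DecaysLeftOn w Set.univ := by
  intro t ht
  have hneg0 : ∀ t : ℝ, 0 < t → ∀ᶠ n : ℕ in atTop, w (-n) ≤ t * w 0 := fun t ht =>
    (hneg t ht).mono fun n hn => by simpa using hn 0 Set.self_mem_Iic
  have hpos0 : ∀ t : ℝ, 0 < t → ∀ᶠ n : ℕ in atTop, w 0 ≤ t * w n := fun t ht =>
    (hpos t ht).mono fun n hn => by simpa using hn 0 le_rfl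
  obtain ⟨B, hB, hwB⟩ := exists_forall_le_mul_of_eventually_le (fun _ => hw 0)
    (by simpa using hneg0 1 one_pos)
  obtain ⟨C, hC, hwC⟩ := exists_forall_le_mul_of_eventually_le (fun n => hw n)
    (by simpa using hpos0 1 one_pos)
  obtain ⟨p₀, hp₀⟩ := eventually_atTop.1 ((hneg0 (t / C) (by positivity)).and (hneg t ht))
  obtain ⟨q₀, hq₀⟩ := eventually_atTop.1 ((hpos0 (t / B) (by positivity)).and (hpos t ht))
  filter_upwards [eventually_ge_atTop (p₀ + q₀)] with n hn k _
  rcases le_total k 0 with hk | hk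
  · exact (hp₀ n (by omega)).2 k hk
  rcases le_total (n : ℤ) k with hnk | hnk
  · simpa using (hq₀ n (by omega)).2 (k - n) (by omega)
  obtain ⟨q, rfl⟩ := Int.eq_ofNat_of_zero_le hk
  obtain ⟨p, hp⟩ : ∃ p : ℕ, (q - n : ℤ) = -p := ⟨n - q, by omega⟩
  rw [hp]
  rcases (by omega : p₀ ≤ p ∨ q₀ ≤ q) with hlong | hlong
  · calc w (-p) ≤ t / C * w 0 := (hp₀ p hlong).1
      _ ≤ t / C * (C * w q) := by gcongr; exact hwC q
      _ = t * w q := by field_simp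
  · calc w (-p) ≤ B * w 0 := hwB p
      _ ≤ B * (t / B * w q) := by gcongr; exact (hq₀ q hlong).1
      _ = t * w q := by field_simp

namespace DecaysLeftOn

variable {J : Set ℤ} {k : ℤ} {s : ℝ}

lemma eventually_lt (h : DecaysLeftOn w J) (hk : k ∈ J) (hw : 0 < w k) (hs : 0 < s) :
    ∀ᶠ n : ℕ in atTop, w (k - n) < s := by
  filter_upwards [h (s / (2 * w k)) (by positivity)] with n hn
  calc w (k - n) ≤ s / (2 * w k) * w k := hn k hk
    _ = s / 2 := by field_simp
    _ < s := half_lt_self hs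

lemma exists_gt (h : DecaysLeftOn w Set.univ) (hw : 0 < w 0) (hs : 0 < s) : ∃ k, s < w k := by
  obtain ⟨n, hn⟩ := (h (w 0 / (2 * s)) (by positivity)).exists
  have hle : w 0 ≤ w 0 / (2 * s) * w n := by simpa using hn n (Set.mem_univ _)
  refine ⟨n, ?_⟩
  rw [div_mul_eq_mul_div, le_div_iff₀ (by positivity)] at hle
  linarith [le_of_mul_le_mul_left hle hw]

lemma exists_crossing (h : DecaysLeftOn w J) (hk : k ∈ J) (hs : 0 < s) (hsw : s < w k) {n : ℕ}
    (hn : 0 < n) : ∃ m : ℕ, s < w (k - m * n) ∧ w (k - m * n - n) ≤ s := by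
  by_contra! hstep
  have habove : ∀ m : ℕ, s < w (k - m * n) := by
    intro m
    induction m with
    | zero => simpa using hsw
    | succ m ih =>
      rw [show k - (m + 1 : ℕ) * n = k - m * n - n by push_cast; ring]
      exact hstep m ih
  obtain ⟨m, hm⟩ := ((tendsto_id.atTop_mul_const' hn).eventually
    (h.eventually_lt hk (hs.trans hsw) hs)).exists
  exact absurd (habove m) (by simpa using hm.le)

end DecaysLeftOn

end Rates

section IteratedSystems

variable {X : Type*}

lemma zpow_image_zpow_image (φ : Equiv.Perm X) (j k : ℤ) (A : Set X) :
    (φ ^ j : Equiv.Perm X) '' ((φ ^ k : Equiv.Perm X) '' A) =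
      (φ ^ (j + k) : Equiv.Perm X) '' A := by
  rw [← Set.image_comp, zpow_add, Equiv.Perm.coe_mul]

lemma zpow_image_eq_preimage (φ : Equiv.Perm X) (k : ℤ) (A : Set X) :
    (φ ^ k : Equiv.Perm X) '' A = (φ ^ (-k) : Equiv.Perm X) ⁻¹' A := by
  rw [zpow_neg, Equiv.Perm.inv_def, Equiv.image_eq_preimage_symm]

lemma inv_zpow_image (φ : Equiv.Perm X) (k : ℤ) (A : Set X) :
    (φ⁻¹ ^ k : Equiv.Perm X) '' A = (φ ^ (-k) : Equiv.Perm X) '' A := by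
  rw [inv_zpow']

lemma mem_biUnion_zpow_image_of_apply_mem {φ : Equiv.Perm X} {A : Set X} {i : ℤ} {x : X}
    (hx : φ x ∈ ⋃ k ∈ Set.Iic i, (φ ^ k : Equiv.Perm X) '' A) :
    x ∈ ⋃ k ∈ Set.Iic i, (φ ^ k : Equiv.Perm X) '' A := by
  obtain ⟨k, hk, y, hy, hyx⟩ := Set.mem_iUnion₂.1 hx
  refine Set.mem_iUnion₂.2 ⟨k - 1, (sub_one_lt k).le.trans hk, y, hy, φ.injective ?_⟩
  rw [← hyx, ← Equiv.Perm.mul_apply, ← zpow_one_add, add_sub_cancel]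

namespace IsCompositionSystem

variable [MeasurableSpace X] {μ : Measure X} {φ ψ : Equiv.Perm X} {A : Set X}

lemma one : IsCompositionSystem μ (1 : Equiv.Perm X) where
  measurable := measurable_id
  measurable_symm := measurable_id
  bound := ⟨1, one_pos, fun A _ => by simp⟩

lemma mul (hφ : IsCompositionSystem μ φ) (hψ : IsCompositionSystem μ ψ) :
    IsCompositionSystem μ (φ * ψ) where
  measurable := hφ.measurable.comp hψ.measurable
  measurable_symm := hψ.measurable_symm.comp hφ.measurable_symm
  bound := by
    obtain ⟨b, hb, hφb⟩ := hφ.bound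
    obtain ⟨c, hc, hψc⟩ := hψ.bound
    refine ⟨c * b, mul_pos hc hb, fun A hA => ?_⟩
    calc μ (⇑(φ * ψ) ⁻¹' A) ≤ c * μ (φ ⁻¹' A) := hψc _ (hφ.measurable hA)
      _ ≤ c * (b * μ A) := by gcongr; exact hφb A hA
      _ = (c * b : ℝ≥0) * μ A := by rw [ENNReal.coe_mul, mul_assoc]

lemma pow (h : IsCompositionSystem μ φ) (n : ℕ) : IsCompositionSystem μ (φ ^ n) := by
  induction n with
  | zero => exact one
  | succ n ih => rw [pow_succ]; exact ih.mul h

lemma zpow (h : IsCompositionSystem μ φ) (h' : IsCompositionSystem μ φ⁻¹) (k : ℤ) :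
    IsCompositionSystem μ (φ ^ k) := by
  obtain ⟨n, rfl | rfl⟩ := k.eq_nat_or_neg
  · simpa only [zpow_natCast] using h.pow n
  · simpa only [zpow_neg, zpow_natCast, inv_pow] using h'.pow n

lemma measurableSet_zpow_image (h : IsCompositionSystem μ φ) (h' : IsCompositionSystem μ φ⁻¹)
    (k : ℤ) (hA : MeasurableSet A) : MeasurableSet ((φ ^ k : Equiv.Perm X) '' A) := by
  rw [zpow_image_eq_preimage]
  exact (h.zpow h' (-k)).measurable hA

lemma measure_zpow_image_le (h : IsCompositionSystem μ φ) (h' : IsCompositionSystem μ φ⁻¹)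
    (k : ℤ) : ∃ c : ℝ≥0, ∀ A : Set X, MeasurableSet A →
      μ ((φ ^ k : Equiv.Perm X) '' A) ≤ c * μ A := by
  obtain ⟨c, -, hc⟩ := (h.zpow h' (-k)).bound
  exact ⟨c, by simpa only [zpow_image_eq_preimage] using hc⟩

lemma measure_zpow_image_ne_top (h : IsCompositionSystem μ φ) (h' : IsCompositionSystem μ φ⁻¹)
    (k : ℤ) (hA : MeasurableSet A) (hfin : μ A ≠ ∞) : μ ((φ ^ k : Equiv.Perm X) '' A) ≠ ∞ := by
  obtain ⟨c, hc⟩ := h.measure_zpow_image_le h' k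
  exact ne_top_of_le_ne_top (ENNReal.mul_ne_top ENNReal.coe_ne_top hfin) (hc A hA)

lemma measure_zpow_image_eq_zero_iff (h : IsCompositionSystem μ φ)
    (h' : IsCompositionSystem μ φ⁻¹) (k : ℤ) : μ ((φ ^ k : Equiv.Perm X) '' A) = 0 ↔ μ A = 0 := by
  refine ⟨fun h0 => ?_, fun h0 => ?_⟩
  · simpa only [Set.preimage_image_eq _ (φ ^ k).injective] using
      (h.zpow h' k).quasi.preimage_null h0
  · rw [zpow_image_eq_preimage]
    exact (h.zpow h' (-k)).quasi.preimage_null h0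

end IsCompositionSystem

end IteratedSystems

section DistortionSystems

variable {X : Type*} [MeasurableSpace X] {Φ : YoungFunction} {μ : Measure X} {φ : Equiv.Perm X}
  {W F : Set X}

/-- The gauge norm of the indicator function of the level `φᵏ(W)`. -/
noncomputable def levelGauge (Φ : YoungFunction) (μ : Measure X) (φ : Equiv.Perm X) (W : Set X)
    (k : ℤ) : ℝ :=
  indicatorGauge Φ μ ((φ ^ k : Equiv.Perm X) '' W)

lemma levelGauge_inv (k : ℤ) : levelGauge Φ μ φ⁻¹ W k = levelGauge Φ μ φ W (-k) := by
  rw [levelGauge, levelGauge, inv_zpow_image]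

lemma indicatorNorm_eq_indicatorGauge (k : ℤ) :
    indicatorNorm Φ μ φ k F = indicatorGauge Φ μ ((φ ^ (-k) : Equiv.Perm X) '' F) := by
  rw [zpow_image_eq_preimage, neg_neg]
  rfl

lemma IsDissipative.inv (hW : IsDissipative μ φ W) : IsDissipative μ φ⁻¹ W where
  measurableSet := hW.measurableSet
  pos := hW.pos
  lt_top := hW.lt_top
  iUnion_eq := by
    simp only [inv_zpow_image]
    rw [← hW.iUnion_eq]
    exact (Equiv.neg ℤ).iSup_comp (g := fun k : ℤ => (φ ^ k : Equiv.Perm X) '' W)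
  disjoint := fun j k hjk => by
    simp only [inv_zpow_image]
    exact hW.disjoint (neg_injective.ne hjk)

lemma HasBoundedDistortion.inv (h : HasBoundedDistortion Φ μ φ W) :
    HasBoundedDistortion Φ μ φ⁻¹ W := by
  obtain ⟨K, hK, h⟩ := h
  have hreflect : ∀ (k : ℤ) (F : Set X), indicatorNorm Φ μ φ⁻¹ k F = indicatorNorm Φ μ φ (-k) F :=
    fun k F => by
      rw [indicatorNorm_eq_indicatorGauge, indicatorNorm_eq_indicatorGauge, inv_zpow_image]
  refine ⟨K, hK, fun k F hF hFW hpos => ?_⟩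
  simpa only [hreflect, neg_zero] using h (-k) F hF hFW hpos

/-- An invertible dissipative system of bounded distortion, for a Young function that is finite at
some positive point, so that the indicator functions of the levels have positive gauge norm. -/
structure IsDistortionSystem (Φ : YoungFunction) (μ : Measure X) (φ : Equiv.Perm X) (W : Set X) :
    Prop where
  comp : IsCompositionSystem μ φ
  comp_inv : IsCompositionSystem μ φ⁻¹
  exists_ne_top : ∃ x, 0 < x ∧ Φ x ≠ ∞
  dissipative : IsDissipative μ φ W
  distortion : HasBoundedDistortion Φ μ φ W

namespace IsDistortionSystem

lemma inv (h : IsDistortionSystem Φ μ φ W) : IsDistortionSystem Φ μ φ⁻¹ W where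
  comp := h.comp_inv
  comp_inv := by rw [inv_inv]; exact h.comp
  exists_ne_top := h.exists_ne_top
  dissipative := h.dissipative.inv
  distortion := h.distortion.inv

lemma measurableSet_level (h : IsDistortionSystem Φ μ φ W) (k : ℤ) :
    MeasurableSet ((φ ^ k : Equiv.Perm X) '' W) :=
  h.comp.measurableSet_zpow_image h.comp_inv k h.dissipative.measurableSet

lemma measure_zpow_image_ne_top (h : IsDistortionSystem Φ μ φ W) (hF : MeasurableSet F)
    (hFW : F ⊆ W) (k : ℤ) : μ ((φ ^ k : Equiv.Perm X) '' F) ≠ ∞ :=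
  h.comp.measure_zpow_image_ne_top h.comp_inv k hF
    (measure_ne_top_of_subset hFW h.dissipative.lt_top.ne)

lemma indicatorGauge_zpow_image_pos (h : IsDistortionSystem Φ μ φ W) (hF : MeasurableSet F)
    (hFW : F ⊆ W) (hpos : 0 < μ F) (k : ℤ) :
    0 < indicatorGauge Φ μ ((φ ^ k : Equiv.Perm X) '' F) :=
  indicatorGauge_pos h.exists_ne_top (h.comp.measurableSet_zpow_image h.comp_inv k hF)
    (h.measure_zpow_image_ne_top hF hFW k)
    ((h.comp.measure_zpow_image_eq_zero_iff h.comp_inv k).not.2 hpos.ne')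

lemma measure_level_ne_top (h : IsDistortionSystem Φ μ φ W) (k : ℤ) :
    μ ((φ ^ k : Equiv.Perm X) '' W) ≠ ∞ :=
  h.measure_zpow_image_ne_top h.dissipative.measurableSet subset_rfl k

lemma measure_level_ne_zero (h : IsDistortionSystem Φ μ φ W) (k : ℤ) :
    μ ((φ ^ k : Equiv.Perm X) '' W) ≠ 0 :=
  (h.comp.measure_zpow_image_eq_zero_iff h.comp_inv k).not.2 h.dissipative.pos.ne'

lemma levelGauge_pos (h : IsDistortionSystem Φ μ φ W) (k : ℤ) : 0 < levelGauge Φ μ φ W k :=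
  h.indicatorGauge_zpow_image_pos h.dissipative.measurableSet subset_rfl h.dissipative.pos k

lemma orbitInverse_eq (h : IsDistortionSystem Φ μ φ W) (k : ℤ) :
    orbitInverse Φ μ φ W k = ENNReal.ofReal (levelGauge Φ μ φ W k)⁻¹ :=
  YoungFunction.inverse_one_div_measure h.exists_ne_top (h.measurableSet_level k)
    (h.measure_level_ne_top k) (h.measure_level_ne_zero k)

lemma exists_indicatorGauge_mul_levelGauge_le (h : IsDistortionSystem Φ μ φ W) :
    ∃ K : ℝ, 0 < K ∧ ∀ F : Set X, MeasurableSet F → F ⊆ W → 0 < μ F → ∀ i j : ℤ,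
      indicatorGauge Φ μ ((φ ^ i : Equiv.Perm X) '' F) * levelGauge Φ μ φ W j ≤
        K * (levelGauge Φ μ φ W i * indicatorGauge Φ μ ((φ ^ j : Equiv.Perm X) '' F)) := by
  obtain ⟨K, hK, hd⟩ := h.distortion
  refine ⟨K ^ 2, by positivity, fun F hF hFW hpos i j => ?_⟩
  set w := levelGauge Φ μ φ W
  set g : ℤ → ℝ := fun k => indicatorGauge Φ μ ((φ ^ k : Equiv.Perm X) '' F)
  have hw : ∀ k, 0 < w k := h.levelGauge_pos
  have hg : ∀ k, 0 < g k := h.indicatorGauge_zpow_image_pos hF hFW hpos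
  have hbounds : ∀ k, 1 / K * (w k / w 0) ≤ g k / g 0 ∧ g k / g 0 ≤ K * (w k / w 0) := fun k => by
    have hk := hd (-k) F hF hFW hpos
    simp only [indicatorNorm_eq_indicatorGauge, neg_neg, neg_zero] at hk
    exact hk
  have hw0 := hw 0
  have hg0 := hg 0
  calc g i * w j = g i / g 0 * (1 / K * (w j / w 0)) * (K * g 0 * w 0) := by field_simp
    _ ≤ K * (w i / w 0) * (g j / g 0) * (K * g 0 * w 0) := by
        have hwi := hw i
        have hwj := hw j
        gcongr
        exacts [(hbounds i).2, (hbounds j).1]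
    _ = K ^ 2 * (w i * g j) := by field_simp

lemma exists_measure_zpow_image_le (h : IsDistortionSystem Φ μ φ W) {J : Set ℤ}
    (hJ : DecaysLeftOn (levelGauge Φ μ φ W) J) {t : ℝ≥0} (ht : 0 < t) :
    ∃ n : ℕ, ∀ k ∈ J, ∀ F : Set X, MeasurableSet F → F ⊆ W →
      μ ((φ ^ (k - n) : Equiv.Perm X) '' F) ≤ t * μ ((φ ^ k : Equiv.Perm X) '' F) := by
  obtain ⟨K, hK, hd⟩ := h.exists_indicatorGauge_mul_levelGauge_le
  set s : ℝ≥0 := min t 1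
  have hs : (0 : ℝ) < s := lt_min ht one_pos
  obtain ⟨n, hn⟩ := (hJ (s / (2 * K)) (by positivity)).exists
  refine ⟨n, fun k hk F hF hFW => ?_⟩
  rcases eq_zero_or_pos (μ F) with h0 | hpos
  · simp [(h.comp.measure_zpow_image_eq_zero_iff h.comp_inv _).2 h0]
  have hw := h.levelGauge_pos k
  have hg := h.indicatorGauge_zpow_image_pos hF hFW hpos k
  suffices hgauge : indicatorGauge Φ μ ((φ ^ (k - n) : Equiv.Perm X) '' F) <
      s * indicatorGauge Φ μ ((φ ^ k : Equiv.Perm X) '' F) by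
    refine (measure_le_of_indicatorGauge_lt h.exists_ne_top
      (h.comp.measurableSet_zpow_image h.comp_inv k hF)
      (h.comp.measurableSet_zpow_image h.comp_inv _ hF)
      (h.measure_zpow_image_ne_top hF hFW _) (min_le_right t 1) hgauge).trans ?_
    gcongr
    exact min_le_left t 1
  refine lt_of_mul_lt_mul_right ?_ hw.le
  calc _ ≤ K * (levelGauge Φ μ φ W (k - n) * indicatorGauge Φ μ ((φ ^ k : Equiv.Perm X) '' F)) :=
        hd F hF hFW hpos _ _
    _ ≤ K * (s / (2 * K) * levelGauge Φ μ φ W k *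
          indicatorGauge Φ μ ((φ ^ k : Equiv.Perm X) '' F)) := by gcongr; exact hn k hk
    _ = s * indicatorGauge Φ μ ((φ ^ k : Equiv.Perm X) '' F) * levelGauge Φ μ φ W k / 2 := by
        field_simp
    _ < _ := half_lt_self (by positivity)

lemma map_restrict_level_le (h : IsDistortionSystem Φ μ φ W) {n : ℕ} {k : ℤ} {t : ℝ≥0}
    (hn : ∀ F : Set X, MeasurableSet F → F ⊆ W →
      μ ((φ ^ (k - n) : Equiv.Perm X) '' F) ≤ t * μ ((φ ^ k : Equiv.Perm X) '' F)) :
    (μ.map (φ ^ n : Equiv.Perm X)).restrict ((φ ^ k : Equiv.Perm X) '' W) ≤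
      (t : ℝ≥0∞) • μ.restrict ((φ ^ k : Equiv.Perm X) '' W) := by
  refine Measure.le_iff.2 fun A hA => ?_
  set F : Set X := (φ ^ k : Equiv.Perm X) ⁻¹' A ∩ W
  have hpiece : (φ ^ k : Equiv.Perm X) '' F = A ∩ (φ ^ k : Equiv.Perm X) '' W :=
    Set.image_preimage_inter _ _ _
  have hshift : (φ ^ n : Equiv.Perm X) ⁻¹' (A ∩ (φ ^ k : Equiv.Perm X) '' W) =
      (φ ^ (k - n) : Equiv.Perm X) '' F := by
    rw [← hpiece, ← zpow_natCast, ← neg_neg (n : ℤ), ← zpow_image_eq_preimage,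
      zpow_image_zpow_image, neg_neg, neg_add_eq_sub]
  rw [Measure.restrict_apply hA, Measure.smul_apply, Measure.restrict_apply hA, smul_eq_mul,
    Measure.map_apply (h.comp.pow n).measurable (hA.inter (h.measurableSet_level k)), hshift,
    ← hpiece]
  exact hn F (((h.comp.zpow h.comp_inv k).measurable hA).inter h.dissipative.measurableSet)
    Set.inter_subset_right

lemma exists_map_restrict_le (h : IsDistortionSystem Φ μ φ W) {J : Set ℤ}
    (hJ : DecaysLeftOn (levelGauge Φ μ φ W) J) {t : ℝ≥0} (ht : 0 < t) :
    ∃ n : ℕ, (μ.map (φ ^ n : Equiv.Perm X)).restrict (⋃ k ∈ J, (φ ^ k : Equiv.Perm X) '' W) ≤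
      (t : ℝ≥0∞) • μ.restrict (⋃ k ∈ J, (φ ^ k : Equiv.Perm X) '' W) := by
  obtain ⟨n, hn⟩ := h.exists_measure_zpow_image_le hJ ht
  have hsum := fun ν : Measure X => Measure.restrict_biUnion (μ := ν) (T := J) J.to_countable
    (fun _ _ _ _ hjk => h.dissipative.disjoint hjk) h.measurableSet_level
  refine ⟨n, Measure.le_iff.2 fun A hA => ?_⟩
  rw [hsum, hsum, Measure.smul_apply, Measure.sum_apply _ hA, Measure.sum_apply _ hA, smul_eq_mul,
    ← ENNReal.tsum_mul_left]
  exact ENNReal.tsum_le_tsum fun k => h.map_restrict_level_le (hn k k.2) A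

lemma measure_biUnion_level_Iic_ne_top (h : IsDistortionSystem Φ μ φ W) {i : ℤ}
    (hi : DecaysLeftOn (levelGauge Φ μ φ W) (Set.Iic i)) :
    μ (⋃ k ∈ Set.Iic i, (φ ^ k : Equiv.Perm X) '' W) ≠ ∞ := by
  obtain ⟨n, hn⟩ := h.exists_measure_zpow_image_le hi (t := 1 / 2) (by norm_num)
  have hsum : Summable fun m : ℕ => (μ ((φ ^ (i - m) : Equiv.Perm X) '' W)).toReal := by
    refine summable_of_add_le_mul (fun _ => ENNReal.toReal_nonneg) (n := n)
      (c := (1 / 2 : ℝ≥0)) (by norm_num) fun m => ?_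
    have hle := hn (i - m) (sub_le_self i m.cast_nonneg) W h.dissipative.measurableSet subset_rfl
    rw [sub_sub, ← Nat.cast_add, add_comm m n] at hle
    simpa only [ENNReal.toReal_mul, ENNReal.coe_toReal] using
      ENNReal.toReal_mono (ENNReal.mul_ne_top ENNReal.coe_ne_top (h.measure_level_ne_top _)) hle
  refine ne_top_of_le_ne_top hsum.tsum_ofReal_ne_top ?_
  simp only [ENNReal.ofReal_toReal (h.measure_level_ne_top _)]
  refine (measure_mono (Set.iUnion₂_subset fun k hk => ?_)).trans (measure_iUnion_le _)
  obtain ⟨m, hm⟩ := Int.eq_ofNat_of_zero_le (sub_nonneg.2 (Set.mem_Iic.1 hk))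
  obtain rfl : k = i - m := by omega
  exact Set.subset_iUnion (fun m : ℕ => (φ ^ (i - m) : Equiv.Perm X) '' W) m

end IsDistortionSystem

end DistortionSystems

section Contraction

variable {X : Type*} [MeasurableSpace X] {Φ : YoungFunction} {μ : Measure X} {φ : Equiv.Perm X}
  {W S : Set X} {D : ℝ≥0} {b : ℝ≥0∞}

lemma setLIntegral_two_mul_le (hΦ : ∀ v, Φ (2 * v) ≤ D * Φ v + b) (f : X → ℝ) :
    ∫⁻ x in S, Φ (2 * f x) ∂μ ≤ D * orliczModular Φ μ f + b * μ S :=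
  calc ∫⁻ x in S, Φ (2 * f x) ∂μ ≤ ∫⁻ x in S, (D * Φ (f x) + b) ∂μ :=
        lintegral_mono fun x => hΦ (f x)
    _ = D * ∫⁻ x in S, Φ (f x) ∂μ + b * μ S := by
        rw [lintegral_add_right _ measurable_const, lintegral_const_mul' _ _ ENNReal.coe_ne_top,
          setLIntegral_const]
    _ ≤ D * orliczModular Φ μ f + b * μ S := by
        gcongr
        exact setLIntegral_le_lintegral S _

namespace IsCompositionSystem

lemma orliczModular_compositionOperator_pow (h : IsCompositionSystem μ φ) (n : ℕ)
    (hS : MeasurableSet S) {f : OrliczSpace Φ μ}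
    (hf : ∀ᵐ x ∂μ, x ∉ S → (f : X →ₘ[μ] ℝ) x = 0) (a : ℝ) :
    orliczModular Φ μ (fun x => a * ((h.compositionOperator Φ ^ n) f : X →ₘ[μ] ℝ) x) =
      ∫⁻ x in S, Φ (a * (f : X →ₘ[μ] ℝ) x) ∂(μ.map (φ ^ n : Equiv.Perm X)) := by
  have hφ := (h.pow n).quasi
  have hmeas : Measurable fun x => Φ (a * (f : X →ₘ[μ] ℝ) x) := Φ.measurable.comp
    ((f : X →ₘ[μ] ℝ).stronglyMeasurable.measurable.const_mul a)
  calc orliczModular Φ μ (fun x => a * ((h.compositionOperator Φ ^ n) f : X →ₘ[μ] ℝ) x)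
      = ∫⁻ x, Φ (a * (f : X →ₘ[μ] ℝ) ((φ ^ n : Equiv.Perm X) x)) ∂μ :=
        orliczModular_congr Φ μ <| (h.coeFn_compositionOperator_pow n f).mono fun x hx => by
          simp only [hx, Function.comp_apply]
    _ = ∫⁻ x, Φ (a * (f : X →ₘ[μ] ℝ) x) ∂(μ.map (φ ^ n : Equiv.Perm X)) :=
        (lintegral_map hmeas hφ.measurable).symm
    _ = ∫⁻ x in S, Φ (a * (f : X →ₘ[μ] ℝ) x) ∂(μ.map (φ ^ n : Equiv.Perm X)) := by
        rw [← lintegral_indicator hS]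
        refine lintegral_congr_ae ?_
        filter_upwards [hφ.absolutelyContinuous.ae_le hf] with x hx
        by_cases hxS : x ∈ S <;> simp [hxS, hx, Φ.map_zero]

lemma exists_contraction (h : IsCompositionSystem μ φ) (hS : MeasurableSet S)
    (hμ : ∀ t : ℝ≥0, 0 < t → ∃ n : ℕ,
      (μ.map (φ ^ n : Equiv.Perm X)).restrict S ≤ (t : ℝ≥0∞) • μ.restrict S)
    (hΦ : ∀ v, Φ (2 * v) ≤ D * Φ v + b) (hb : b * μ S ≠ ∞) :
    ∃ n : ℕ, ∃ c : ℝ≥0, c < 1 ∧ ∀ f : OrliczSpace Φ μ,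
      (∀ᵐ x ∂μ, x ∉ S → (f : X →ₘ[μ] ℝ) x = 0) →
        ‖(h.compositionOperator Φ ^ n) f‖ ≤ c * ‖f‖ := by
  set B : ℝ≥0 := D + (b * μ S).toNNReal + 1
  have hB : 0 < B := by positivity
  obtain ⟨n, hn⟩ := hμ B⁻¹ (inv_pos.2 hB)
  refine ⟨n, 1 / 2, by norm_num, fun f hf =>
    OrliczSpace.norm_le_mul_of_modular (by norm_num) fun a _ hfa => ?_⟩
  calc orliczModular Φ μ
        (fun x => ((h.compositionOperator Φ ^ n) f : X →ₘ[μ] ℝ) x / ((1 / 2 : ℝ≥0) * a))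
      = orliczModular Φ μ (fun x => 2 / a * ((h.compositionOperator Φ ^ n) f : X →ₘ[μ] ℝ) x) := by
        congr 1 with x
        push_cast
        field_simp
    _ = ∫⁻ x in S, Φ (2 / a * (f : X →ₘ[μ] ℝ) x) ∂(μ.map (φ ^ n : Equiv.Perm X)) :=
        h.orliczModular_compositionOperator_pow n hS hf _
    _ ≤ ∫⁻ x, Φ (2 / a * (f : X →ₘ[μ] ℝ) x) ∂(((B⁻¹ : ℝ≥0) : ℝ≥0∞) • μ.restrict S) :=
        lintegral_mono' hn le_rfl
    _ = (B⁻¹ : ℝ≥0) * ∫⁻ x in S, Φ (2 * ((f : X →ₘ[μ] ℝ) x / a)) ∂μ := by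
        rw [lintegral_smul_measure, smul_eq_mul]
        simp only [div_mul_eq_mul_div, mul_div_assoc]
    _ ≤ (B⁻¹ : ℝ≥0) * (D * 1 + b * μ S) := by
        gcongr
        refine (setLIntegral_two_mul_le hΦ _).trans ?_
        gcongr
    _ ≤ (B⁻¹ : ℝ≥0) * B := by
        gcongr
        rw [mul_one, ENNReal.coe_add, ENNReal.coe_add, ENNReal.coe_toNNReal hb]
        exact le_self_add
    _ = 1 := by rw [← ENNReal.coe_mul, inv_mul_cancel₀ hB.ne', ENNReal.coe_one]

end IsCompositionSystem

namespace IsDistortionSystem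

variable {J : Set ℤ}

lemma measurableSet_biUnion_level (h : IsDistortionSystem Φ μ φ W) (J : Set ℤ) :
    MeasurableSet (⋃ k ∈ J, (φ ^ k : Equiv.Perm X) '' W) :=
  MeasurableSet.biUnion J.to_countable fun k _ => h.measurableSet_level k

lemma le_mul_of_levelGauge (h : IsDistortionSystem Φ μ φ W) {i j : ℤ} {c : ℝ≥0}
    (hc : μ ((φ ^ i : Equiv.Perm X) '' W) ≤ c * μ ((φ ^ j : Equiv.Perm X) '' W)) {v v' : ℝ}
    (hv : 0 < v) (hi : v⁻¹ < levelGauge Φ μ φ W i) (hj : levelGauge Φ μ φ W j < v'⁻¹) :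
    Φ v' ≤ c * Φ v := by
  have hlower := one_lt_of_lt_indicatorGauge (h.measurableSet_level i) (inv_pos.2 hv) hi
  have hupper := le_one_of_indicatorGauge_lt h.exists_ne_top (h.measurableSet_level j)
    (h.measure_level_ne_top j) hj
  rw [inv_inv] at hlower hupper
  calc Φ v' ≤ Φ v' * (Φ v * μ ((φ ^ i : Equiv.Perm X) '' W)) := le_mul_of_one_le_right' hlower.le
    _ ≤ Φ v' * (Φ v * (c * μ ((φ ^ j : Equiv.Perm X) '' W))) := by gcongr
    _ = c * Φ v * (Φ v' * μ ((φ ^ j : Equiv.Perm X) '' W)) := by ring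
    _ ≤ c * Φ v := mul_le_of_le_one_right' hupper

lemma exists_doubling (h : IsDistortionSystem Φ μ φ W) (hJ : IsLowerSet J)
    (hdecay : DecaysLeftOn (levelGauge Φ μ φ W) J) :
    ∃ D : ℝ≥0, ∀ i ∈ J, ∀ v : ℝ, (levelGauge Φ μ φ W i)⁻¹ < v → Φ (2 * v) ≤ D * Φ v := by
  obtain ⟨n, hn, hn0⟩ :=
    ((hdecay (1 / 4) (by norm_num)).and (eventually_gt_atTop 0)).exists
  obtain ⟨D, hD⟩ := h.comp.measure_zpow_image_le h.comp_inv (n + n)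
  refine ⟨D, fun i hi v hv => ?_⟩
  have hv0 : 0 < v := (inv_pos.2 (h.levelGauge_pos i)).trans hv
  obtain ⟨m, habove, hbelow⟩ := hdecay.exists_crossing hi (inv_pos.2 hv0)
    (inv_lt_of_inv_lt₀ (h.levelGauge_pos i) hv) hn0
  set k : ℤ := i - m * n
  have hk : k - n ∈ J := hJ (by simp only [k]; linarith [show (0 : ℤ) ≤ m * n + n by positivity]) hi
  have hsmall : levelGauge Φ μ φ W (k - n - n) < (2 * v)⁻¹ :=
    calc levelGauge Φ μ φ W (k - n - n) ≤ 1 / 4 * v⁻¹ := (hn _ hk).trans (by gcongr)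
      _ < 1 / 2 * v⁻¹ := by gcongr; norm_num
      _ = (2 * v)⁻¹ := by rw [mul_inv, one_div]
  refine h.le_mul_of_levelGauge ?_ hv0 habove hsmall
  simpa only [zpow_image_zpow_image, sub_sub, add_sub_cancel] using
    hD _ (h.measurableSet_level (k - n - n))

lemma ne_top_of_decaysLeftOn (h : IsDistortionSystem Φ μ φ W)
    (hdecay : DecaysLeftOn (levelGauge Φ μ φ W) J) {i : ℤ} (hi : i ∈ J) {v : ℝ} (hv : 0 < v) :
    Φ v ≠ ∞ := by
  obtain ⟨n, hn⟩ := (hdecay.eventually_lt hi (h.levelGauge_pos i) (inv_pos.2 hv)).exists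
  have hle := le_one_of_indicatorGauge_lt h.exists_ne_top (h.measurableSet_level (i - n))
    (h.measure_level_ne_top _) hn
  rw [inv_inv] at hle
  intro htop
  simp [htop, ENNReal.top_mul (h.measure_level_ne_zero _)] at hle

lemma exists_contraction_univ (h : IsDistortionSystem Φ μ φ W)
    (hdecay : DecaysLeftOn (levelGauge Φ μ φ W) Set.univ) :
    ∃ n : ℕ, ∃ c : ℝ≥0, c < 1 ∧ ∀ f : OrliczSpace Φ μ,
      ‖(h.comp.compositionOperator Φ ^ n) f‖ ≤ c * ‖f‖ := by
  obtain ⟨D, hD⟩ := h.exists_doubling isLowerSet_univ hdecay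
  have hdouble : ∀ v, Φ (2 * v) ≤ D * Φ v + 0 := fun v => by
    rw [add_zero, ← Φ.map_abs v, ← Φ.map_abs (2 * v), abs_mul, abs_two]
    rcases (abs_nonneg v).eq_or_lt with h0 | hv
    · simp [← h0, Φ.map_zero]
    · obtain ⟨i, hi⟩ := hdecay.exists_gt (h.levelGauge_pos 0) (inv_pos.2 hv)
      exact hD i (Set.mem_univ i) _ (inv_lt_of_inv_lt₀ hv hi)
  have hμ := fun (t : ℝ≥0) (ht : 0 < t) => h.exists_map_restrict_le hdecay ht
  simp only [Set.mem_univ, Set.iUnion_true, h.dissipative.iUnion_eq] at hμ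
  simpa using h.comp.exists_contraction MeasurableSet.univ hμ hdouble (by simp)

lemma exists_contraction_Iic (h : IsDistortionSystem Φ μ φ W) {i : ℤ}
    (hdecay : DecaysLeftOn (levelGauge Φ μ φ W) (Set.Iic i)) :
    ∃ n : ℕ, ∃ c : ℝ≥0, c < 1 ∧ ∀ f : OrliczSpace Φ μ,
      (∀ᵐ x ∂μ, x ∉ ⋃ k ∈ Set.Iic i, (φ ^ k : Equiv.Perm X) '' W → (f : X →ₘ[μ] ℝ) x = 0) →
        ‖(h.comp.compositionOperator Φ ^ n) f‖ ≤ c * ‖f‖ := by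
  obtain ⟨D, hD⟩ := h.exists_doubling (isLowerSet_Iic i) hdecay
  have hw := inv_pos.2 (h.levelGauge_pos i)
  have hdouble : ∀ v, Φ (2 * v) ≤ D * Φ v + Φ (2 * (levelGauge Φ μ φ W i)⁻¹) := fun v => by
    rw [← Φ.map_abs v, ← Φ.map_abs (2 * v), abs_mul, abs_two]
    rcases le_or_gt |v| (levelGauge Φ μ φ W i)⁻¹ with hv | hv
    · exact (Φ.mono (by positivity) (by gcongr)).trans le_add_self
    · exact (hD i Set.self_mem_Iic _ hv).trans le_self_add
  exact h.comp.exists_contraction (h.measurableSet_biUnion_level _)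
    (fun t ht => h.exists_map_restrict_le hdecay ht) hdouble
    (ENNReal.mul_ne_top (h.ne_top_of_decaysLeftOn hdecay Set.self_mem_Iic (by positivity))
      (h.measure_biUnion_level_Iic_ne_top hdecay))

lemma mem_biUnion_level_or_mem_biUnion_level_inv (h : IsDistortionSystem Φ μ φ W) (x : X) :
    x ∈ (⋃ k ∈ Set.Iic (0 : ℤ), (φ ^ k : Equiv.Perm X) '' W) ∨
      x ∈ ⋃ k ∈ Set.Iic (0 : ℤ), (φ⁻¹ ^ k : Equiv.Perm X) '' W := by
  obtain ⟨k, hk⟩ := Set.mem_iUnion.1 (h.dissipative.iUnion_eq.symm ▸ Set.mem_univ x)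
  refine (le_total k 0).imp (fun hk0 => Set.mem_biUnion hk0 hk) fun hk0 =>
    Set.mem_biUnion (neg_nonpos.2 hk0) ?_
  rwa [inv_zpow_image, neg_neg]

theorem isStronglyStructurallyStable_of_decaysLeftOn_univ (h : IsDistortionSystem Φ μ φ W)
    (hdecay : DecaysLeftOn (levelGauge Φ μ φ W) Set.univ) :
    IsStronglyStructurallyStable (h.comp.compositionOperator Φ) := by
  refine h.comp.isStronglyStructurallyStable_of_contracting h.comp_inv MeasurableSet.univ
    (fun _ _ => Set.mem_univ _) ?_ ⟨0, 0, one_pos, fun f hf => ?_⟩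
  · obtain ⟨n, c, hc, hn⟩ := h.exists_contraction_univ hdecay
    exact ⟨n, c, hc, fun f _ => hn f⟩
  · have hf0 : f = 0 := OrliczSpace.eq_zero_of_ae (by simpa using hf)
    simp [hf0]

theorem isStronglyStructurallyStable_of_decaysLeftOn_univ_inv (h : IsDistortionSystem Φ μ φ W)
    (hdecay : DecaysLeftOn (levelGauge Φ μ φ⁻¹ W) Set.univ) :
    IsStronglyStructurallyStable (h.comp.compositionOperator Φ) := by
  refine h.comp.isStronglyStructurallyStable_of_contracting h.comp_inv MeasurableSet.empty
    (fun _ hx => hx.elim) ⟨0, 0, one_pos, fun f hf => ?_⟩ ?_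
  · have hf0 : f = 0 := OrliczSpace.eq_zero_of_ae (by simpa using hf)
    simp [hf0]
  · obtain ⟨n, c, hc, hn⟩ := h.inv.exists_contraction_univ hdecay
    exact ⟨n, c, hc, fun f _ => hn f⟩

theorem isStronglyStructurallyStable_of_decaysLeftOn_Iic (h : IsDistortionSystem Φ μ φ W)
    (hdecay : DecaysLeftOn (levelGauge Φ μ φ W) (Set.Iic 0))
    (hdecay' : DecaysLeftOn (levelGauge Φ μ φ⁻¹ W) (Set.Iic 0)) :
    IsStronglyStructurallyStable (h.comp.compositionOperator Φ) := by
  refine h.comp.isStronglyStructurallyStable_of_contracting h.comp_inv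
    (h.measurableSet_biUnion_level (Set.Iic 0))
    (fun _ => mem_biUnion_zpow_image_of_apply_mem) (h.exists_contraction_Iic hdecay) ?_
  obtain ⟨n, c, hc, hn⟩ := h.inv.exists_contraction_Iic hdecay'
  refine ⟨n, c, hc, fun f hf => hn f (hf.mono fun x hx hxS => hx ?_)⟩
  exact (h.mem_biUnion_level_or_mem_biUnion_level_inv x).resolve_right hxS

end IsDistortionSystem

end Contraction

section Main

variable {X : Type*} [MeasurableSpace X] {Φ : YoungFunction} {μ : Measure X} {φ : Equiv.Perm X}
  {W : Set X}

namespace IsDistortionSystem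

lemma decaysLeftOn_univ_of_limsup_lt_one (h : IsDistortionSystem Φ μ φ W)
    (hlim : limsup (fun n : ℕ => ⨆ k : ℤ,
      (orbitInverse Φ μ φ W (k + n) / orbitInverse Φ μ φ W k) ^ (1 / (n : ℝ))) atTop < 1) :
    DecaysLeftOn (levelGauge Φ μ φ W) Set.univ := fun _ ht =>
  (eventually_le_mul_of_limsup_lt_one h.levelGauge_pos h.orbitInverse_eq (i := fun n k => k + n)
    (j := fun _ k => k) hlim ht).mono fun n hn k _ => by simpa using hn (k - n)

lemma decaysLeftOn_univ_inv_of_one_lt_liminf (h : IsDistortionSystem Φ μ φ W)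
    (hlim : 1 < liminf (fun n : ℕ => ⨅ k : ℤ,
      (orbitInverse Φ μ φ W (k + n) / orbitInverse Φ μ φ W k) ^ (1 / (n : ℝ))) atTop) :
    DecaysLeftOn (levelGauge Φ μ φ⁻¹ W) Set.univ := fun _ ht =>
  (eventually_le_mul_of_one_lt_liminf h.levelGauge_pos h.orbitInverse_eq (i := fun n k => k + n)
    (j := fun _ k => k) hlim ht).mono fun n hn k _ => by
      simpa only [levelGauge_inv, neg_sub', sub_neg_eq_add] using hn (-k)

lemma decaysLeftOn_Iic_of_limsup_lt_one (h : IsDistortionSystem Φ μ φ W)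
    (hlim : limsup (fun n : ℕ => ⨆ k : {k : ℤ // k ≤ 0},
      (orbitInverse Φ μ φ W k / orbitInverse Φ μ φ W (k - n)) ^ (1 / (n : ℝ))) atTop < 1) :
    DecaysLeftOn (levelGauge Φ μ φ W) (Set.Iic 0) := fun _ ht =>
  (eventually_le_mul_of_limsup_lt_one h.levelGauge_pos h.orbitInverse_eq
    (i := fun _ (k : {k : ℤ // k ≤ 0}) => k) (j := fun n k => k - n) hlim ht).mono
      fun _ hn k hk => hn ⟨k, hk⟩

lemma decaysLeftOn_Iic_inv_of_one_lt_liminf (h : IsDistortionSystem Φ μ φ W)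
    (hlim : 1 < liminf (fun n : ℕ => ⨅ k : {k : ℤ // 0 ≤ k},
      (orbitInverse Φ μ φ W (k + n) / orbitInverse Φ μ φ W k) ^ (1 / (n : ℝ))) atTop) :
    DecaysLeftOn (levelGauge Φ μ φ⁻¹ W) (Set.Iic 0) := fun _ ht =>
  (eventually_le_mul_of_one_lt_liminf h.levelGauge_pos h.orbitInverse_eq
    (i := fun n (k : {k : ℤ // 0 ≤ k}) => k + n) (j := fun _ k => k) hlim ht).mono
      fun n hn k hk => by
        simpa only [levelGauge_inv, neg_sub', sub_neg_eq_add] using hn ⟨-k, neg_nonneg.2 hk⟩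

lemma decaysLeftOn_univ_of_limsup_of_liminf (h : IsDistortionSystem Φ μ φ W)
    (hneg : limsup (fun n : ℕ => ⨆ k : {k : ℤ // k ≤ 0},
      (orbitInverse Φ μ φ W k / orbitInverse Φ μ φ W (k - n)) ^ (1 / (n : ℝ))) atTop < 1)
    (hpos : 1 < liminf (fun n : ℕ => ⨅ k : {k : ℤ // 0 ≤ k},
      (orbitInverse Φ μ φ W k / orbitInverse Φ μ φ W (k + n)) ^ (1 / (n : ℝ))) atTop) :
    DecaysLeftOn (levelGauge Φ μ φ W) Set.univ :=
  decaysLeftOn_univ_of_half_lines h.levelGauge_pos (h.decaysLeftOn_Iic_of_limsup_lt_one hneg)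
    fun _ ht => (eventually_le_mul_of_one_lt_liminf h.levelGauge_pos h.orbitInverse_eq
      (i := fun _ (k : {k : ℤ // 0 ≤ k}) => k) (j := fun n k => k + n) hpos ht).mono
        fun _ hn k hk => hn ⟨k, hk⟩

end IsDistortionSystem

lemma OrliczSpace.subsingleton_of_eq_top (hΦ : ∀ x, 0 < x → Φ x = ∞) :
    Subsingleton (OrliczSpace Φ μ) := by
  refine subsingleton_of_forall_eq 0 fun f => OrliczSpace.eq_zero_of_ae ?_
  obtain ⟨k, hk, hf⟩ := f.2
  have hmeas : Measurable fun x => Φ (k * (f : X →ₘ[μ] ℝ) x) :=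
    Φ.measurable.comp ((f : X →ₘ[μ] ℝ).stronglyMeasurable.measurable.const_mul k)
  filter_upwards [ae_lt_top hmeas hf.ne] with x hx
  contrapose! hx
  rw [← Φ.map_abs, hΦ _ (abs_pos.2 (mul_ne_zero hk.ne' hx))]

lemma isStronglyStructurallyStable_of_subsingleton {E : Type*} [NormedAddCommGroup E]
    [NormedSpace ℝ E] [Subsingleton E] (T : E →L[ℝ] E) : IsStronglyStructurallyStable T :=
  ⟨isUnit_of_subsingleton T, fun ε hε => ⟨1, one_pos, fun _ _ _ =>
    ⟨Homeomorph.refl E, fun _ => Subsingleton.elim _ _, fun x => by simpa using hε.le⟩⟩⟩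

end Main

theorem mainTheorem4_general {X : Type*} [MeasurableSpace X] (μ : Measure X)
    (Φ : YoungFunction) (φ : Equiv.Perm X) (hφ : IsCompositionSystem μ φ)
    (hinv : ∃ c : ℝ≥0, 0 < c ∧ ∀ A : Set X, MeasurableSet A → μ (φ '' A) ≤ c * μ A)
    (W : Set X) (hW : IsDissipative μ φ W) (hdist : HasBoundedDistortion Φ μ φ W)
    (hcond :
      (limsup (fun n : ℕ => ⨆ k : ℤ,
          (orbitInverse Φ μ φ W (k + n) / orbitInverse Φ μ φ W k) ^ (1 / (n : ℝ))) atTop < 1) ∨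
      (1 < liminf (fun n : ℕ => ⨅ k : ℤ,
          (orbitInverse Φ μ φ W (k + n) / orbitInverse Φ μ φ W k) ^ (1 / (n : ℝ))) atTop) ∨
      (limsup (fun n : ℕ => ⨆ k : {k : ℤ // k ≤ 0},
          (orbitInverse Φ μ φ W k / orbitInverse Φ μ φ W (k - n)) ^ (1 / (n : ℝ))) atTop < 1 ∧
        (1 < liminf (fun n : ℕ => ⨅ k : {k : ℤ // 0 ≤ k},
            (orbitInverse Φ μ φ W (k + n) / orbitInverse Φ μ φ W k) ^ (1 / (n : ℝ))) atTop ∨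
          1 < liminf (fun n : ℕ => ⨅ k : {k : ℤ // 0 ≤ k},
            (orbitInverse Φ μ φ W k / orbitInverse Φ μ φ W (k + n)) ^ (1 / (n : ℝ))) atTop))) :
    IsStronglyStructurallyStable (hφ.compositionOperator Φ) := by
  by_cases hΦ : ∃ x, 0 < x ∧ Φ x ≠ ∞
  · have h : IsDistortionSystem Φ μ φ W := ⟨hφ, hφ.inv hinv, hΦ, hW, hdist⟩
    rcases hcond with hc | hd | ⟨hneg, hpos | hpos⟩
    · exact h.isStronglyStructurallyStable_of_decaysLeftOn_univ
        (h.decaysLeftOn_univ_of_limsup_lt_one hc)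
    · exact h.isStronglyStructurallyStable_of_decaysLeftOn_univ_inv
        (h.decaysLeftOn_univ_inv_of_one_lt_liminf hd)
    · exact h.isStronglyStructurallyStable_of_decaysLeftOn_Iic
        (h.decaysLeftOn_Iic_of_limsup_lt_one hneg) (h.decaysLeftOn_Iic_inv_of_one_lt_liminf hpos)
    · exact h.isStronglyStructurallyStable_of_decaysLeftOn_univ
        (h.decaysLeftOn_univ_of_limsup_of_liminf hneg hpos)
  · push Not at hΦ
    have := OrliczSpace.subsingleton_of_eq_top (μ := μ) hΦ
    exact isStronglyStructurallyStable_of_subsingleton _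

theorem mainTheorem4 {X : Type*} [MeasurableSpace X] (μ : Measure X) [SigmaFinite μ]
    (Φ : YoungFunction) (hΦ : Φ.DeltaPrime)
    (φ : Equiv.Perm X) (hφ : IsCompositionSystem μ φ)
    (hinv : ∃ c : ℝ≥0, 0 < c ∧ ∀ A : Set X, MeasurableSet A → μ (φ '' A) ≤ c * μ A)
    (W : Set X) (hW : IsDissipative μ φ W) (hdist : HasBoundedDistortion Φ μ φ W)
    (hcond :
      (limsup (fun n : ℕ => ⨆ k : ℤ,
          (orbitInverse Φ μ φ W (k + n) / orbitInverse Φ μ φ W k) ^ (1 / (n : ℝ))) atTop < 1) ∨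
      (1 < liminf (fun n : ℕ => ⨅ k : ℤ,
          (orbitInverse Φ μ φ W (k + n) / orbitInverse Φ μ φ W k) ^ (1 / (n : ℝ))) atTop) ∨
      (limsup (fun n : ℕ => ⨆ k : {k : ℤ // k ≤ 0},
          (orbitInverse Φ μ φ W k / orbitInverse Φ μ φ W (k - n)) ^ (1 / (n : ℝ))) atTop < 1 ∧
        (1 < liminf (fun n : ℕ => ⨅ k : {k : ℤ // 0 ≤ k},
            (orbitInverse Φ μ φ W (k + n) / orbitInverse Φ μ φ W k) ^ (1 / (n : ℝ))) atTop ∨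
          1 < liminf (fun n : ℕ => ⨅ k : {k : ℤ // 0 ≤ k},
            (orbitInverse Φ μ φ W k / orbitInverse Φ μ φ W (k + n)) ^ (1 / (n : ℝ))) atTop))) :
    IsStronglyStructurallyStable (hφ.compositionOperator Φ) :=
  mainTheorem4_general μ Φ φ hφ hinv W hW hdist hcond
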